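/- Fix $a\in(0,1)$. Call a closed filled rhombus in $\mathbb{R}^2$ with axis-parallel diagonals \emph{horizontal} if its width and height are in the ratio $1:a$, and \emph{vertical} if they are in the ratio $a:1$. Start with the horizontal rhombus of height $2$ and width $2/a$ centred at the origin. At iteration $1$, place the largest possible vertical rhombus inside it; this splits the remaining space into two polygons, the \emph{empty polygons} of iteration $1$. In general, at iteration $k\ge 2$, place into each empty polygon of iteration $k-1$ the largest possible rhombus, vertical if $k$ is odd and horizontal if $k$ is even. The empty polygons of iteration $k$ are the closed filled polygons that remain, that is, the closures of the connected components of the interior of each previous polygon minus the rhombus placed in it. Let $F^a_k$ be the union of all empty polygons of iteration $k$, and let \[F^a=\bigcap_{k=1}^\infty F^a_k .\] Then the Hausdorff dimension $\dim_{\mathrm H}F^a$, as a function of $a\in(0,1)$, attains its maximum at $a=1/\sqrt3$, where its value is $\log_3 4$. Furthermore, \[\lim_{a\searrow 0}\dim_{\mathrm H}F^a=\lim_{a\nearrow 1}\dim_{\mathrm H}F^a=1 .\] -/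

import Mathlib

open Set Filter Topology

noncomputable section

namespace Gasket

/-- The Euclidean plane. -/
abbrev Plane : Type := EuclideanSpace ℝ (Fin 2)

/-- The closed filled rhombus with centre `c`, horizontal diagonal `2 * w` and vertical
diagonal `2 * h` (used for `w, h > 0` only). -/
def rhombus (c : Plane) (w h : ℝ) : Set Plane :=
  {x | |x 0 - c 0| / w + |x 1 - c 1| / h ≤ 1}

/-- The horizontal rhombus (width : height is `1 : a`) with long diagonal `2 * s`. -/
def horizontalRhombus (a : ℝ) (c : Plane) (s : ℝ) : Set Plane :=
  rhombus c s (a * s)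

/-- The vertical rhombus (width : height is `a : 1`) with long diagonal `2 * s`. -/
def verticalRhombus (a : ℝ) (c : Plane) (s : ℝ) : Set Plane :=
  rhombus c (a * s) s

/-- The rhombi that may be placed at iteration `k`: vertical for odd `k`, horizontal for
even `k`. -/
def iterationRhombus (a : ℝ) (k : ℕ) (c : Plane) (s : ℝ) : Set Plane :=
  if Odd k then verticalRhombus a c s else horizontalRhombus a c s

/-- `R` is a largest rhombus of the orientation of iteration `k` that lies within `P`. -/
def IsLargestRhombus (a : ℝ) (k : ℕ) (P R : Set Plane) : Prop :=
  ∃ (c : Plane) (s : ℝ), 0 < s ∧ R = iterationRhombus a k c s ∧ R ⊆ P ∧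
    ∀ (c' : Plane) (s' : ℝ), 0 < s' → iterationRhombus a k c' s' ⊆ P → s' ≤ s

/-- The closed polygons into which the interior of `P` is split when `R` is removed: the closures
of the connected components of `interior P \ R`. -/
def pieces (P R : Set Plane) : Set (Set Plane) :=
  {Q | ∃ x ∈ interior P \ R, Q = closure (connectedComponentIn (interior P \ R) x)}

/-- The initial rhombus: horizontal, centred at the origin, of height `2` and width `2 / a`. -/
def initialRhombus (a : ℝ) : Set Plane :=
  rhombus 0 (1 / a) 1

/-- For `k ≥ 1`, the set of (closed, filled) empty polygons at iteration `k`. The recursion starts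
from the initial rhombus at `k = 0`; at iteration `k + 1` a largest rhombus of the orientation of
that iteration is placed into each polygon present, and the pieces left over are the new
polygons. -/
def emptyPolygons (a : ℝ) : ℕ → Set (Set Plane)
  | 0 => {initialRhombus a}
  | k + 1 => {Q | ∃ P ∈ emptyPolygons a k, ∃ R, IsLargestRhombus a (k + 1) P R ∧ Q ∈ pieces P R}

/-- The union of all the empty polygons at iteration `k`. -/
def stage (a : ℝ) (k : ℕ) : Set Plane :=
  ⋃ P ∈ emptyPolygons a k, P

/-- The fractal: the intersection of the stages `k = 1, 2, 3, …`. -/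
def fractal (a : ℝ) : Set Plane :=
  ⋂ k ∈ Set.Ici (1 : ℕ), stage a k

end Gasket

end

/-! Up to similarity, only two shapes of empty polygon occur. The initial rhombus leaves a nonconvex
`dart` and its mirror image, a dart leaves a `triangle` and its mirror image, and a triangle leaves
a triangle scaled by `a` and a dart scaled by `σ = (1 - a ^ 2) / 2` (`children_initialRhombus`,
`children_dart`, `children_triangle`). Hence the part of the fractal in one triangle is the
attractor of three similarities of ratios `a`, `σ`, `σ`, and the fractal is a union of four
isometric copies of it.

This attractor is a curve: the three subtriangles form a chain in which neighbours touch at one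
point, where they lie in cones on opposite sides of a line. Let `a ^ s + 2 * σ ^ s = 1`. Three
affine maps of the unit interval, of ratios `a ^ s`, `σ ^ s`, `σ ^ s`, imitate the chain. If `π` and
`τ` code the curve and the interval by the same sequences, then `dist (π ω) (π ω') ^ s` and `|τ ω -
τ ω'|` agree up to a constant factor (`IsCoding.exists_comparable`). The correspondence is therefore
Hölder in both directions, with exponents `1 / s` and `s`, and the dimension is `s`
(`IsCoding.dimH_range`).

The rest is the study of this equation. Its left side decreases in `s` and is at least `1` at `s =
1`, so the dimension is at least `1`, and `a ^ t + 2 * σ ^ t ≤ 1` gives the upper bound `t`. Near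
both ends of the parameter range every `t > 1` is such a bound. For `t = log_3 4` the inequality
holds for all `a`, with equality at `a ^ 2 = 1 / 3` (`pressure_le_one`): the sign of the derivative
in `x = a ^ 2` is that of a convex function minus a constant. -/

noncomputable section

namespace Gasket

/-! ### Sets that are star-shaped about an interior point -/

section StarShaped

variable {E : Type*} [NormedAddCommGroup E] [NormedSpace ℝ E] {p : E} {U P : Set E}

/-- The dart is not convex, so interior, closure and connectedness are all derived from one weaker
condition: half-open segments from a centre `p` to points of `P` stay in `U`. -/
theorem isPreconnected_of_lineMap_mem (hUP : U ⊆ P)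
    (h : ∀ q ∈ P, ∀ t : ℝ, 0 ≤ t → t < 1 → AffineMap.lineMap p q t ∈ U) : IsPreconnected U := by
  refine isPreconnected_of_forall p fun q hq => ?_
  refine ⟨segment ℝ p q, ?_, left_mem_segment ℝ p q, right_mem_segment ℝ p q,
    (convex_segment p q).isPreconnected⟩
  rw [segment_eq_image_lineMap]
  rintro _ ⟨t, ht, rfl⟩
  rcases ht.2.lt_or_eq with h1 | rfl
  · exact h q (hUP hq) t ht.1 h1
  · simpa using hq

theorem closure_eq_of_lineMap_mem (hUP : U ⊆ P) (hP : IsClosed P)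
    (h : ∀ q ∈ P, ∀ t : ℝ, 0 ≤ t → t < 1 → AffineMap.lineMap p q t ∈ U) : closure U = P := by
  refine (closure_minimal hUP hP).antisymm fun q hq => ?_
  have hc : Tendsto (fun t : ℝ => AffineMap.lineMap p q t) (𝓝[<] 1) (𝓝 q) := by
    have : Continuous fun t : ℝ => (AffineMap.lineMap p q t : E) :=
      AffineMap.lineMap_continuous
    simpa using (this.tendsto 1).mono_left nhdsWithin_le_nhds
  refine mem_closure_of_tendsto hc ?_
  filter_upwards [Ioo_mem_nhdsLT (show (0 : ℝ) < 1 by norm_num)] with t ht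
  exact h q hq t ht.1.le ht.2

theorem interior_eq_of_lineMap_mem (hUP : U ⊆ P) (hU : IsOpen U)
    (h : ∀ q ∈ P, ∀ t : ℝ, 0 ≤ t → t < 1 → AffineMap.lineMap p q t ∈ U) : interior P = U := by
  refine Subset.antisymm (fun q hq => ?_) (interior_maximal hUP hU)
  have hc : Tendsto (fun t : ℝ => AffineMap.lineMap p q t) (𝓝[>] 1) (𝓝 q) := by
    have : Continuous fun t : ℝ => (AffineMap.lineMap p q t : E) :=
      AffineMap.lineMap_continuous
    simpa using (this.tendsto 1).mono_left nhdsWithin_le_nhds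
  obtain ⟨t, ht, ht1⟩ := ((hc.eventually (mem_interior_iff_mem_nhds.1 hq)).and
    self_mem_nhdsWithin).exists
  have ht1 : (1 : ℝ) < t := ht1
  -- An interior point can be pushed slightly away from `p` within `P`; it then lies strictly inside
  -- the segment to the pushed point.
  have := h _ ht t⁻¹ (by positivity) (inv_lt_one_of_one_lt₀ ht1)
  have e : (AffineMap.lineMap p (AffineMap.lineMap p q t : E) t⁻¹ : E) = q := by
    simp [AffineMap.lineMap_apply, smul_smul, inv_mul_cancel₀ (by linarith : t ≠ 0)]
  rwa [e] at this

end StarShaped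

/-! ### Pieces -/

theorem pieces_eq_pair {P R U V : Set Plane} (hPR : interior P \ R = U ∪ V) (hU : IsOpen U)
    (hV : IsOpen V) (hUV : Disjoint U V) (hU' : IsPreconnected U) (hV' : IsPreconnected V)
    (hUn : U.Nonempty) (hVn : V.Nonempty) : pieces P R = {closure U, closure V} := by
  have key : ∀ {U V : Set Plane}, IsOpen U → IsOpen V → Disjoint U V → IsPreconnected U →
      ∀ x ∈ U, connectedComponentIn (U ∪ V) x = U := by
    intro U V hU hV hUV hU' x hx
    refine Subset.antisymm ?_ (hU'.subset_connectedComponentIn hx subset_union_left)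
    exact isPreconnected_connectedComponentIn.subset_left_of_subset_union hU hV hUV
      (connectedComponentIn_subset _ _) ⟨x, mem_connectedComponentIn (Or.inl hx), hx⟩
  ext Q
  simp only [pieces, hPR, mem_ofPred_eq, mem_insert_iff, mem_singleton_iff]
  constructor
  · rintro ⟨x, hx | hx, rfl⟩
    · exact Or.inl (by rw [key hU hV hUV hU' x hx])
    · exact Or.inr (by rw [union_comm, key hV hU hUV.symm hV' x hx])
  · rintro (rfl | rfl)
    · obtain ⟨x, hx⟩ := hUn
      exact ⟨x, Or.inl hx, by rw [key hU hV hUV hU' x hx]⟩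
    · obtain ⟨x, hx⟩ := hVn
      exact ⟨x, Or.inr hx, by rw [union_comm, key hV hU hUV.symm hV' x hx]⟩

theorem pieces_image (f : Plane ≃ₜ Plane) (P R : Set Plane) :
    pieces (f '' P) (f '' R) = image f '' pieces P R := by
  have e : interior (f '' P) \ f '' R = f '' (interior P \ R) := by
    rw [image_sdiff f.injective, f.image_interior]
  ext Q
  simp only [pieces, e, mem_ofPred_eq, mem_image]
  constructor
  · rintro ⟨_, ⟨x, hx, rfl⟩, rfl⟩
    exact ⟨_, ⟨x, hx, rfl⟩, by
      rw [f.image_closure, f.image_connectedComponentIn hx]⟩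
  · rintro ⟨_, ⟨x, hx, rfl⟩, rfl⟩
    exact ⟨f x, ⟨x, hx, rfl⟩, by
      rw [f.image_closure, f.image_connectedComponentIn hx]⟩

/-! ### Similarities that preserve the coordinate directions -/

/-- A similarity of ratio `r` that keeps the coordinate axes for even `n` and exchanges them for
odd `n`. -/
structure AxisSimilarity (r : ℝ) (n : ℕ) (f : Plane ≃ₜ Plane) : Prop where
  pos : 0 < r
  even : Even n → ∀ x y, |f x 0 - f y 0| = r * |x 0 - y 0| ∧ |f x 1 - f y 1| = r * |x 1 - y 1|
  odd : ¬ Even n → ∀ x y,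
    |f x 0 - f y 0| = r * |x 1 - y 1| ∧ |f x 1 - f y 1| = r * |x 0 - y 0|

theorem dist_plane (x y : Plane) : dist x y = √(|x 0 - y 0| ^ 2 + |x 1 - y 1| ^ 2) := by
  simp [EuclideanSpace.dist_eq, Fin.sum_univ_two, Real.dist_eq]

theorem abs_sub_zero_le_dist (x y : Plane) : |x 0 - y 0| ≤ dist x y := by
  rw [dist_plane]
  exact Real.le_sqrt_of_sq_le (by nlinarith [sq_nonneg |x 1 - y 1|])

theorem abs_sub_one_le_dist (x y : Plane) : |x 1 - y 1| ≤ dist x y := by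
  rw [dist_plane]
  exact Real.le_sqrt_of_sq_le (by nlinarith [sq_nonneg |x 0 - y 0|])

theorem dist_le_abs_add_abs (x y : Plane) : dist x y ≤ |x 0 - y 0| + |x 1 - y 1| := by
  rw [dist_plane]
  exact Real.sqrt_le_iff.2 ⟨by positivity,
    by nlinarith [mul_nonneg (abs_nonneg (x 0 - y 0)) (abs_nonneg (x 1 - y 1))]⟩

namespace AxisSimilarity

variable {r r' : ℝ} {n m : ℕ} {f g : Plane ≃ₜ Plane}

theorem dist_eq (hf : AxisSimilarity r n f) (x y : Plane) : dist (f x) (f y) = r * dist x y := by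
  have hr := hf.pos.le
  by_cases hn : Even n
  · rw [dist_plane, dist_plane, (hf.even hn x y).1, (hf.even hn x y).2]
    rw [show ∀ u v : ℝ, (r * u) ^ 2 + (r * v) ^ 2 = r ^ 2 * (u ^ 2 + v ^ 2) by intros; ring,
      Real.sqrt_mul (by positivity), Real.sqrt_sq hr]
  · rw [dist_plane, dist_plane, (hf.odd hn x y).1, (hf.odd hn x y).2]
    rw [show ∀ u v : ℝ, (r * u) ^ 2 + (r * v) ^ 2 = r ^ 2 * (v ^ 2 + u ^ 2) by intros; ring,
      Real.sqrt_mul (by positivity), Real.sqrt_sq hr]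

theorem trans (hg : AxisSimilarity r' m g) (hf : AxisSimilarity r n f) :
    AxisSimilarity (r * r') (n + m) (g.trans f) := by
  refine ⟨mul_pos hf.pos hg.pos, fun h x y => ?_, fun h x y => ?_⟩ <;>
  simp only [Homeomorph.trans_apply] <;> rw [Nat.even_add] at h <;>
  by_cases hn : Even n <;> by_cases hm : Even m <;> simp only [hn, hm] at h <;>
  first
  | (exfalso; simp at h; done)
  | skip
  · rw [(hf.even hn _ _).1, (hf.even hn _ _).2, (hg.even hm _ _).1, (hg.even hm _ _).2]
    constructor <;> ring
  · rw [(hf.odd hn _ _).1, (hf.odd hn _ _).2, (hg.odd hm _ _).1, (hg.odd hm _ _).2]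
    constructor <;> ring
  · rw [(hf.even hn _ _).1, (hf.even hn _ _).2, (hg.odd hm _ _).1, (hg.odd hm _ _).2]
    constructor <;> ring
  · rw [(hf.odd hn _ _).1, (hf.odd hn _ _).2, (hg.even hm _ _).1, (hg.even hm _ _).2]
    constructor <;> ring

/-- Exchanging the axes exchanges the two orientations, so a similarity acts on the iteration number
by adding `n`, where only the parity counts. This lets each splitting be computed once, for a model
polygon. -/
theorem image_iterationRhombus (hf : AxisSimilarity r n f) (a : ℝ) (k : ℕ) (c : Plane) (s : ℝ) :
    f '' iterationRhombus a k c s = iterationRhombus a (k + n) (f c) (r * s) := by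
  have hr : r ≠ 0 := hf.pos.ne'
  ext y
  obtain ⟨x, rfl⟩ := f.surjective y
  rw [f.injective.mem_set_image]
  by_cases hn : Even n
  · have hk : Odd (k + n) ↔ Odd k := by simp [Nat.odd_add, hn]
    by_cases hk' : Odd k <;>
    simp only [iterationRhombus, hk, hk', verticalRhombus, horizontalRhombus, rhombus,
      mem_ofPred_eq, if_true, if_false, (hf.even hn _ _).1, (hf.even hn _ _).2,
      mul_left_comm a r s, mul_div_mul_left _ _ hr]
  · have hk : Odd (k + n) ↔ ¬ Odd k := by
      rw [Nat.odd_add]; simp [hn]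
    by_cases hk' : Odd k <;>
    simp only [iterationRhombus, hk, hk', verticalRhombus, horizontalRhombus, rhombus,
      mem_ofPred_eq, if_true, if_false, (hf.odd hn _ _).1, (hf.odd hn _ _).2, not_true,
      not_false_iff,
      mul_left_comm a r s, mul_div_mul_left _ _ hr] <;> rw [add_comm]

theorem isLargestRhombus_image_iff (hf : AxisSimilarity r n f) (a : ℝ) (k : ℕ) (P R : Set Plane) :
    IsLargestRhombus a (k + n) (f '' P) (f '' R) ↔ IsLargestRhombus a k P R := by
  have hr := hf.pos
  constructor
  · rintro ⟨c, s, hs, hR, hRP, hmax⟩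
    refine ⟨f.symm c, s / r, by positivity, ?_, (image_subset_image_iff f.injective).1 hRP, ?_⟩
    · apply f.injective.image_injective
      rw [hf.image_iterationRhombus, hR]
      congr 1
      · simp
      · field_simp
    · intro c' s' hs' h
      have := hmax (f c') (r * s') (by positivity)
        (by rw [← hf.image_iterationRhombus]; exact image_mono h)
      rw [le_div_iff₀ hr]; linarith
  · rintro ⟨c, s, hs, rfl, hRP, hmax⟩
    refine ⟨f c, r * s, by positivity, hf.image_iterationRhombus a k c s, image_mono hRP, ?_⟩
    intro c' s' hs' h
    have := hmax (f.symm c') (s' / r) (by positivity) (by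
      rw [← image_subset_image_iff f.injective, hf.image_iterationRhombus]
      convert h using 2
      · simp
      · field_simp)
    rw [div_le_iff₀ hr] at this; linarith

end AxisSimilarity

/-- The polygons that replace `P` at iteration `k`. -/
def children (a : ℝ) (k : ℕ) (P : Set Plane) : Set (Set Plane) :=
  {Q | ∃ R, IsLargestRhombus a k P R ∧ Q ∈ pieces P R}

theorem AxisSimilarity.children_image {r : ℝ} {n : ℕ} {f : Plane ≃ₜ Plane}
    (hf : AxisSimilarity r n f) (a : ℝ) (k : ℕ) (P : Set Plane) :
    children a (k + n) (f '' P) = image f '' children a k P := by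
  ext Q
  constructor
  · rintro ⟨R, hR, hQ⟩
    obtain ⟨R, rfl⟩ := f.surjective.image_surjective R
    rw [pieces_image] at hQ
    obtain ⟨Q, hQ, rfl⟩ := hQ
    exact ⟨Q, ⟨R, (hf.isLargestRhombus_image_iff a k P R).1 hR, hQ⟩, rfl⟩
  · rintro ⟨Q, ⟨R, hR, hQ⟩, rfl⟩
    exact ⟨f '' R, (hf.isLargestRhombus_image_iff a k P R).2 hR,
      by rw [pieces_image]; exact ⟨Q, hQ, rfl⟩⟩

/-- The construction admits every largest rhombus; uniqueness of the centre at the maximal size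
makes the splitting well determined. -/
theorem children_eq_pieces {a : ℝ} {k : ℕ} {P : Set Plane} {c₀ : Plane} {s₀ : ℝ} (hs₀ : 0 < s₀)
    (hP : iterationRhombus a k c₀ s₀ ⊆ P)
    (h : ∀ c s, 0 < s → iterationRhombus a k c s ⊆ P → s ≤ s₀ ∧ (s = s₀ → c = c₀)) :
    children a k P = pieces P (iterationRhombus a k c₀ s₀) := by
  have h₀ : IsLargestRhombus a k P (iterationRhombus a k c₀ s₀) :=
    ⟨c₀, s₀, hs₀, rfl, hP, fun c s hs hsP => (h c s hs hsP).1⟩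
  ext Q
  constructor
  · rintro ⟨R, ⟨c, s, hs, rfl, hR, hmax⟩, hQ⟩
    have e : s = s₀ := le_antisymm (h c s hs hR).1 (hmax c₀ s₀ hs₀ hP)
    rwa [(h c s hs hR).2 e, e] at hQ
  · exact fun hQ => ⟨_, h₀, hQ⟩

/-- The similarity `x ↦ c + (e₀ x₀, e₁ x₁)`. -/
def scaling (c : Plane) (e₀ e₁ : ℝ) (h₀ : e₀ ≠ 0) (h₁ : e₁ ≠ 0) : Plane ≃ₜ Plane where
  toFun x := !₂[c 0 + e₀ * x 0, c 1 + e₁ * x 1]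
  invFun x := !₂[(x 0 - c 0) / e₀, (x 1 - c 1) / e₁]
  left_inv x := by ext i; fin_cases i <;> simp <;> field_simp
  right_inv x := by ext i; fin_cases i <;> simp <;> field_simp <;> ring
  continuous_toFun := by
    refine (PiLp.continuous_toLp 2 _).comp (continuous_pi fun i => ?_)
    fin_cases i <;> simp <;> fun_prop
  continuous_invFun := by
    refine (PiLp.continuous_toLp 2 _).comp (continuous_pi fun i => ?_)
    fin_cases i <;> simp <;> fun_prop

/-- The exchange of the two coordinates. -/
def swap : Plane ≃ₜ Plane where
  toFun x := !₂[x 1, x 0]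
  invFun x := !₂[x 1, x 0]
  left_inv x := by ext i; fin_cases i <;> simp
  right_inv x := by ext i; fin_cases i <;> simp
  continuous_toFun := by
    refine (PiLp.continuous_toLp 2 _).comp (continuous_pi fun i => ?_)
    fin_cases i <;> simp <;> fun_prop
  continuous_invFun := by
    refine (PiLp.continuous_toLp 2 _).comp (continuous_pi fun i => ?_)
    fin_cases i <;> simp <;> fun_prop

section

variable (c : Plane) (e₀ e₁ : ℝ) (h₀ : e₀ ≠ 0) (h₁ : e₁ ≠ 0) (x : Plane)

@[simp] theorem scaling_apply_zero : scaling c e₀ e₁ h₀ h₁ x 0 = c 0 + e₀ * x 0 := rfl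
@[simp] theorem scaling_apply_one : scaling c e₀ e₁ h₀ h₁ x 1 = c 1 + e₁ * x 1 := rfl
@[simp] theorem swap_apply_zero : swap x 0 = x 1 := rfl
@[simp] theorem swap_apply_one : swap x 1 = x 0 := rfl

theorem axisSimilarity_scaling {r : ℝ} {n : ℕ} (hn : Even n) (hr : |e₀| = r) (hr' : |e₁| = r) :
    AxisSimilarity r n (scaling c e₀ e₁ h₀ h₁) := by
  refine ⟨hr ▸ abs_pos.2 h₀, fun _ x y => ⟨?_, ?_⟩, fun h => absurd hn h⟩
  · rw [← hr, ← abs_mul, mul_sub]; simp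
  · rw [← hr', ← abs_mul, mul_sub]; simp

theorem axisSimilarity_swap : AxisSimilarity 1 1 swap :=
  ⟨one_pos, fun h => absurd h (by decide), fun _ x y => by simp⟩

end

/-! ### The two kinds of empty polygons and their pieces -/

theorem plane_ext {x y : Plane} (h₀ : x 0 = y 0) (h₁ : x 1 = y 1) : x = y := by
  ext i; fin_cases i <;> assumption

theorem mem_scaling_image {c : Plane} {e₀ e₁ : ℝ} {h₀ : e₀ ≠ 0} {h₁ : e₁ ≠ 0} {S : Set Plane}
    {x : Plane} : x ∈ scaling c e₀ e₁ h₀ h₁ '' S ↔ !₂[(x 0 - c 0) / e₀, (x 1 - c 1) / e₁] ∈ S := by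
  rw [Homeomorph.image_eq_preimage_symm]
  rfl

theorem mem_iterationRhombus_even {a : ℝ} (ha : 0 < a) {k : ℕ} (hk : Even k) {c : Plane} {s : ℝ}
    (hs : 0 < s) {x : Plane} :
    x ∈ iterationRhombus a k c s ↔ a * |x 0 - c 0| + |x 1 - c 1| ≤ a * s := by
  rw [iterationRhombus, if_neg (by simpa using hk), horizontalRhombus, rhombus, mem_ofPred_eq,
    show ∀ u v : ℝ, u / s + v / (a * s) = (a * u + v) / (a * s) by intros; field_simp,
    div_le_one (by positivity)]

theorem mem_iterationRhombus_odd {a : ℝ} (ha : 0 < a) {k : ℕ} (hk : Odd k) {c : Plane} {s : ℝ}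
    (hs : 0 < s) {x : Plane} :
    x ∈ iterationRhombus a k c s ↔ |x 0 - c 0| + a * |x 1 - c 1| ≤ a * s := by
  rw [iterationRhombus, if_pos hk, verticalRhombus, rhombus, mem_ofPred_eq,
    show ∀ u v : ℝ, u / (a * s) + v / s = (u + a * v) / (a * s) by intros; field_simp,
    div_le_one (by positivity)]

/-- The reflection in the vertical axis. -/
def mirrorX : Plane ≃ₜ Plane := scaling 0 (-1) 1 (by norm_num) (by norm_num)

/-- The reflection in the horizontal axis. -/
def mirrorY : Plane ≃ₜ Plane := scaling 0 1 (-1) (by norm_num) (by norm_num)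

theorem axisSimilarity_mirrorX {n : ℕ} (hn : Even n) : AxisSimilarity 1 n mirrorX :=
  axisSimilarity_scaling _ _ _ _ _ hn (by simp) (by simp)

theorem axisSimilarity_mirrorY {n : ℕ} (hn : Even n) : AxisSimilarity 1 n mirrorY :=
  axisSimilarity_scaling _ _ _ _ _ hn (by simp) (by simp)

/-- The right one of the two empty polygons of iteration `1`. -/
def dart (a : ℝ) : Set Plane := {x | a * x 0 + |x 1| ≤ 1 ∧ a ≤ x 0 + a * |x 1|}

/-- The interior of `dart a`. -/
def openDart (a : ℝ) : Set Plane := {x | a * x 0 + |x 1| < 1 ∧ a < x 0 + a * |x 1|}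

/-- The upper one of the two empty polygons that are left of `dart a`. -/
def triangle (a : ℝ) : Set Plane :=
  {x | a * x 0 + x 1 ≤ 1 ∧ a ≤ x 0 + a * x 1 ∧ a * (x 0 - a) ≤ x 1}

/-- The interior of `triangle a`. -/
def openTriangle (a : ℝ) : Set Plane :=
  {x | a * x 0 + x 1 < 1 ∧ a < x 0 + a * x 1 ∧ a * (x 0 - a) < x 1}

theorem lineMap_plane (p q : Plane) (t : ℝ) (i : Fin 2) :
    (AffineMap.lineMap p q t : Plane) i = (1 - t) * p i + t * q i := by
  simp [AffineMap.lineMap_apply]; ring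

section

variable {a : ℝ}

theorem isOpen_openDart : IsOpen (openDart a) := by
  rw [openDart, ofPred_and]
  exact (isOpen_lt (by fun_prop) (by fun_prop)).inter (isOpen_lt (by fun_prop) (by fun_prop))

theorem isClosed_dart : IsClosed (dart a) := by
  rw [dart, ofPred_and]
  exact (isClosed_le (by fun_prop) (by fun_prop)).inter (isClosed_le (by fun_prop) (by fun_prop))

theorem isOpen_openTriangle : IsOpen (openTriangle a) := by
  rw [openTriangle, ofPred_and, ofPred_and]
  exact (isOpen_lt (by fun_prop) (by fun_prop)).inter
    ((isOpen_lt (by fun_prop) (by fun_prop)).inter (isOpen_lt (by fun_prop) (by fun_prop)))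

theorem isClosed_triangle : IsClosed (triangle a) := by
  rw [triangle, ofPred_and, ofPred_and]
  exact (isClosed_le (by fun_prop) (by fun_prop)).inter
    ((isClosed_le (by fun_prop) (by fun_prop)).inter (isClosed_le (by fun_prop) (by fun_prop)))

theorem openDart_subset : openDart a ⊆ dart a := fun _ h => ⟨h.1.le, h.2.le⟩

theorem openTriangle_subset : openTriangle a ⊆ triangle a := fun _ h => ⟨h.1.le, h.2.1.le, h.2.2.le⟩

theorem lineMap_mem_openDart (ha : a ∈ Ioo (0 : ℝ) 1) (q : Plane) (hq : q ∈ dart a) (t : ℝ)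
    (ht₀ : 0 ≤ t) (ht : t < 1) : (AffineMap.lineMap !₂[1, 0] q t : Plane) ∈ openDart a := by
  obtain ⟨h₁, h₂⟩ := hq
  obtain ⟨ha₀, ha₁⟩ := ha
  constructor <;> simp only [lineMap_plane] <;> simp [abs_mul, abs_of_nonneg ht₀] <;>
  nlinarith [mul_le_mul_of_nonneg_left h₁ ht₀, mul_le_mul_of_nonneg_left h₂ ht₀,
    mul_pos (sub_pos.2 ht) (sub_pos.2 ha₁)]

theorem lineMap_mem_openTriangle (ha : a ∈ Ioo (0 : ℝ) 1) (q : Plane) (hq : q ∈ triangle a) (t : ℝ)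
    (ht₀ : 0 ≤ t) (ht : t < 1) :
    (AffineMap.lineMap !₂[a, (1 - a ^ 2) / 2] q t : Plane) ∈ openTriangle a := by
  obtain ⟨h₁, h₂, h₃⟩ := hq
  obtain ⟨ha₀, ha₁⟩ := ha
  have ha₂ : 0 < 1 - a ^ 2 := by nlinarith
  have h₄ := mul_pos (sub_pos.2 ht) ha₂
  have h₅ := mul_pos ha₀ h₄
  refine ⟨?_, ?_, ?_⟩ <;> simp only [lineMap_plane] <;> simp <;>
  nlinarith [mul_le_mul_of_nonneg_left h₁ ht₀, mul_le_mul_of_nonneg_left h₂ ht₀,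
    mul_le_mul_of_nonneg_left h₃ ht₀]

theorem closure_openDart (ha : a ∈ Ioo (0 : ℝ) 1) : closure (openDart a) = dart a :=
  closure_eq_of_lineMap_mem openDart_subset isClosed_dart (lineMap_mem_openDart ha)

theorem interior_dart (ha : a ∈ Ioo (0 : ℝ) 1) : interior (dart a) = openDart a :=
  interior_eq_of_lineMap_mem openDart_subset isOpen_openDart (lineMap_mem_openDart ha)

theorem isPreconnected_openDart (ha : a ∈ Ioo (0 : ℝ) 1) : IsPreconnected (openDart a) :=
  isPreconnected_of_lineMap_mem openDart_subset (lineMap_mem_openDart ha)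

theorem closure_openTriangle (ha : a ∈ Ioo (0 : ℝ) 1) : closure (openTriangle a) = triangle a :=
  closure_eq_of_lineMap_mem openTriangle_subset isClosed_triangle (lineMap_mem_openTriangle ha)

theorem interior_triangle (ha : a ∈ Ioo (0 : ℝ) 1) : interior (triangle a) = openTriangle a :=
  interior_eq_of_lineMap_mem openTriangle_subset isOpen_openTriangle (lineMap_mem_openTriangle ha)

theorem isPreconnected_openTriangle (ha : a ∈ Ioo (0 : ℝ) 1) : IsPreconnected (openTriangle a) :=
  isPreconnected_of_lineMap_mem openTriangle_subset (lineMap_mem_openTriangle ha)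

theorem openDart_nonempty (ha : a ∈ Ioo (0 : ℝ) 1) : (openDart a).Nonempty :=
  ⟨!₂[1, 0], by simpa [openDart] using ha.2⟩

theorem openTriangle_nonempty (ha : a ∈ Ioo (0 : ℝ) 1) : (openTriangle a).Nonempty := by
  obtain ⟨ha₀, ha₁⟩ := ha
  have ha₂ : 0 < 1 - a ^ 2 := by nlinarith
  refine ⟨!₂[a, (1 - a ^ 2) / 2], ?_⟩
  simp only [openTriangle, mem_ofPred_eq]
  refine ⟨?_, ?_, ?_⟩ <;> simp [abs_of_pos ha₀] <;> nlinarith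

theorem mem_initialRhombus {x : Plane} :
    x ∈ initialRhombus a ↔ a * |x 0| + |x 1| ≤ 1 := by
  simp [initialRhombus, rhombus, mul_comm]

theorem interior_initialRhombus :
    interior (initialRhombus a) = {x | a * |x 0| + |x 1| < 1} := by
  refine interior_eq_of_lineMap_mem (p := (0 : Plane)) (fun x hx => ?_)
    (isOpen_lt (by fun_prop) (by fun_prop)) fun q hq t ht₀ ht => ?_
  · exact (mem_initialRhombus).2 (le_of_lt hx)
  · rw [mem_initialRhombus] at hq
    simp only [mem_ofPred_eq, lineMap_plane]
    simp [abs_mul, abs_of_nonneg ht₀]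
    nlinarith [mul_le_mul_of_nonneg_left hq ht₀]

theorem children_initialRhombus (ha : a ∈ Ioo (0 : ℝ) 1) :
    children a 1 (initialRhombus a) = {dart a, mirrorX '' dart a} := by
  have ha' := ha
  obtain ⟨ha₀, ha₁⟩ := ha'
  have ha₂ : 0 < 1 - a ^ 2 := by nlinarith
  have hmem : ∀ c : Plane, ∀ s > 0, ∀ x, x ∈ iterationRhombus a 1 c s ↔ _ :=
    fun c s hs x => mem_iterationRhombus_odd ha₀ odd_one hs
  rw [children_eq_pieces (c₀ := 0) one_pos, pieces_eq_pair (U := openDart a)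
    (V := mirrorX '' openDart a) _ isOpen_openDart (mirrorX.isOpenMap _ isOpen_openDart) _
    (isPreconnected_openDart ha)
    ((isPreconnected_openDart ha).image _ mirrorX.continuous.continuousOn) (openDart_nonempty ha)
    ((openDart_nonempty ha).image _), ← mirrorX.image_closure, closure_openDart ha]
  · rw [interior_initialRhombus]
    ext x
    rw [Set.mem_sdiff, hmem _ _ one_pos, mem_union, mirrorX, mem_scaling_image]
    simp only [openDart, mem_ofPred_eq]
    simp
    constructor
    · rintro ⟨h₁, h₂⟩
      rcases abs_cases (x 0) with h | h
      · left; constructor <;> nlinarith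
      · right; constructor <;> nlinarith
    · rintro (⟨h₁, h₂⟩ | ⟨h₁, h₂⟩)
      · have : 0 ≤ x 0 := by nlinarith [mul_lt_mul_of_pos_left h₁ ha₀]
        rw [abs_of_nonneg this]
        exact ⟨h₁, by linarith⟩
      · have : x 0 ≤ 0 := by nlinarith [mul_lt_mul_of_pos_left h₁ ha₀]
        rw [abs_of_nonpos this]
        exact ⟨by linarith, by linarith⟩
  · rw [Set.disjoint_left]
    rintro x h₁ h₂
    rw [mirrorX, mem_scaling_image] at h₂
    simp only [openDart, mem_ofPred_eq] at h₁ h₂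
    simp at h₂
    nlinarith [mul_lt_mul_of_pos_left h₁.1 ha₀, mul_lt_mul_of_pos_left h₂.1 ha₀]
  · intro x hx
    rw [hmem _ _ one_pos] at hx
    rw [mem_initialRhombus]
    simp at hx
    nlinarith [abs_nonneg (x 0), abs_nonneg (x 1)]
  · intro c s hs h
    -- Testing only the top and bottom vertices suffices: adding the two conditions gives `s ≤ 1 - a
    -- * |c 0|`.
    have h₁ := (mem_initialRhombus).1 (@h !₂[c 0, c 1 + s] ((hmem _ _ hs _).2 (by
      simp [abs_of_pos hs])))
    have h₂ := (mem_initialRhombus).1 (@h !₂[c 0, c 1 - s] ((hmem _ _ hs _).2 (by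
      simp [abs_of_pos hs])))
    simp at h₁ h₂
    have h₃ := abs_nonneg (c 0)
    have h₄ := le_abs_self (c 1 + s)
    have h₅ := neg_abs_le (c 1 - s)
    have h₆ := mul_nonneg ha₀.le h₃
    refine ⟨by linarith, fun e => ?_⟩
    have h₇ : |c 0| = 0 := by
      refine le_antisymm ?_ h₃
      by_contra hc
      push Not at hc
      nlinarith [mul_pos ha₀ hc]
    exact plane_ext (by simpa using h₇) (by simp; linarith)

/-- The iteration number `0` stands for any even one. The largest horizontal rhombus has the reflex
vertex `(a, 0)` and the tip `(1 / a, 0)` as the ends of its long diagonal. -/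
theorem children_dart (ha : a ∈ Ioo (0 : ℝ) 1) :
    children a 0 (dart a) = {triangle a, mirrorY '' triangle a} := by
  have ha' := ha
  obtain ⟨ha₀, ha₁⟩ := ha'
  have ha₂ : 0 < 1 - a ^ 2 := by nlinarith
  have hmem : ∀ c : Plane, ∀ s > 0, ∀ x, x ∈ iterationRhombus a 0 c s ↔ _ :=
    fun c s hs x => mem_iterationRhombus_even ha₀ Even.zero hs
  -- `m` and `s₀` are half the sum and half the difference of `1 / a` and `a`, kept multiplied by
  -- `a` to avoid divisions.
  obtain ⟨m, hm⟩ : ∃ m, a * m = (1 + a ^ 2) / 2 := ⟨(1 + a ^ 2) / 2 / a, by field_simp⟩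
  obtain ⟨s₀, hs₀⟩ : ∃ s, a * s = (1 - a ^ 2) / 2 := ⟨(1 - a ^ 2) / 2 / a, by field_simp⟩
  have hs : 0 < s₀ := by
    by_contra hc
    push Not at hc
    nlinarith
  have hcond : ∀ x : Plane, x ∈ iterationRhombus a 0 !₂[m, 0] s₀ ↔
      |a * x 0 - (1 + a ^ 2) / 2| + |x 1| ≤ (1 - a ^ 2) / 2 := by
    intro x
    rw [hmem _ _ hs, hs₀, ← hm, ← mul_sub, abs_mul, abs_of_pos ha₀]
    simp
  rw [children_eq_pieces (c₀ := !₂[m, 0]) hs, pieces_eq_pair (U := openTriangle a)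
    (V := mirrorY '' openTriangle a) _ isOpen_openTriangle (mirrorY.isOpenMap _ isOpen_openTriangle)
    _ (isPreconnected_openTriangle ha)
    ((isPreconnected_openTriangle ha).image _ mirrorY.continuous.continuousOn)
    (openTriangle_nonempty ha)
    ((openTriangle_nonempty ha).image _), ← mirrorY.image_closure, closure_openTriangle ha]
  · rw [interior_dart ha]
    ext x
    rw [Set.mem_sdiff, hcond, mem_union, mirrorY, mem_scaling_image]
    simp only [openDart, openTriangle, mem_ofPred_eq]
    simp
    constructor
    · rintro ⟨⟨h₁, h₂⟩, h₃⟩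
      have h₄ : a * (x 0 - a) < |x 1| := by
        rcases abs_cases (a * x 0 - (1 + a ^ 2) / 2) with h | h <;> nlinarith
      rcases abs_cases (x 1) with h | h <;> rw [h.1] at h₁ h₂ h₄
      · exact Or.inl ⟨h₁, h₂, h₄⟩
      · refine Or.inr ⟨?_, ?_, ?_⟩ <;> linarith
    · rintro (⟨h₁, h₂, h₃⟩ | ⟨h₁, h₂, h₃⟩)
      · have : 0 ≤ x 1 := by nlinarith [mul_lt_mul_of_pos_left h₂ ha₀]
        rw [abs_of_nonneg this]
        refine ⟨⟨h₁, h₂⟩, ?_⟩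
        have := neg_abs_le (a * x 0 - (1 + a ^ 2) / 2)
        nlinarith
      · have : x 1 ≤ 0 := by nlinarith [mul_lt_mul_of_pos_left h₂ ha₀]
        rw [abs_of_nonpos this]
        refine ⟨⟨by linarith, by linarith⟩, ?_⟩
        have := neg_abs_le (a * x 0 - (1 + a ^ 2) / 2)
        nlinarith
  · rw [Set.disjoint_left]
    rintro x h₁ h₂
    rw [mirrorY, mem_scaling_image] at h₂
    simp only [openTriangle, mem_ofPred_eq] at h₁ h₂
    simp at h₂
    nlinarith [mul_lt_mul_of_pos_left h₁.2.1 ha₀, mul_lt_mul_of_pos_left h₂.2.1 ha₀]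
  · intro x hx
    rw [hcond] at hx
    have h₁ := le_abs_self (a * x 0 - (1 + a ^ 2) / 2)
    have h₂ := neg_abs_le (a * x 0 - (1 + a ^ 2) / 2)
    refine ⟨by linarith, ?_⟩
    have h₃ := mul_nonneg (sq_nonneg a) (abs_nonneg (x 1))
    have h₄ : a * a ≤ a * (x 0 + a * |x 1|) := by nlinarith [abs_nonneg (x 1)]
    exact le_of_mul_le_mul_left h₄ ha₀
  · intro c s hs' h
    have h₁ := @h !₂[c 0 + s, c 1] ((hmem _ _ hs' _).2 (by simp [abs_of_pos hs']))
    have h₂ := @h !₂[c 0 - s, c 1] ((hmem _ _ hs' _).2 (by simp [abs_of_pos hs']))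
    simp only [dart, mem_ofPred_eq] at h₁ h₂
    simp at h₁ h₂
    have h₃ := abs_nonneg (c 1)
    have h₄ : a * s ≤ (1 - a ^ 2) / 2 - (1 - a ^ 2) * |c 1| / 2 := by
      nlinarith [mul_le_mul_of_nonneg_left h₂.2 ha₀.le]
    have h₅ := mul_nonneg ha₂.le h₃
    refine ⟨le_of_mul_le_mul_left (by linarith) ha₀, fun e => ?_⟩
    have h₇ : |c 1| = 0 := by
      refine le_antisymm ?_ h₃
      by_contra hc
      push Not at hc
      rw [e] at h₄
      nlinarith [mul_pos ha₂ hc]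
    have h₈ : a * c 0 = a * m := by
      rw [h₇, e] at h₁ h₂
      refine le_antisymm ?_ ?_
      · nlinarith [h₁.1]
      · nlinarith [mul_le_mul_of_nonneg_left h₂.2 ha₀.le]
    exact plane_ext (by simpa using mul_left_cancel₀ ha₀.ne' h₈) (by simpa using h₇)

/-- The similarity that takes `triangle a` onto the piece of it next to its vertex `(0, 1)`. -/
def cornerMap (a : ℝ) (ha : a ≠ 0) : Plane ≃ₜ Plane :=
  swap.trans (scaling !₂[a, 1] (-a) (-a) (neg_ne_zero.2 ha) (neg_ne_zero.2 ha))

/-- The similarity that takes `dart a` onto the second piece of `triangle a`. -/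
def dartMap (a : ℝ) (ha : (1 - a ^ 2) / 2 ≠ 0) : Plane ≃ₜ Plane :=
  scaling !₂[a, (1 - a ^ 2) / 2] ((1 - a ^ 2) / 2) ((1 - a ^ 2) / 2) ha ha

@[simp] theorem cornerMap_zero (ha : a ≠ 0) (x : Plane) : cornerMap a ha x 0 = a - a * x 1 := by
  simp [cornerMap, sub_eq_add_neg]

@[simp] theorem cornerMap_one (ha : a ≠ 0) (x : Plane) : cornerMap a ha x 1 = 1 - a * x 0 := by
  simp [cornerMap, sub_eq_add_neg]

@[simp] theorem dartMap_zero (ha : (1 - a ^ 2) / 2 ≠ 0) (x : Plane) :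
    dartMap a ha x 0 = a + (1 - a ^ 2) / 2 * x 0 := by
  simp [dartMap]

@[simp] theorem dartMap_one (ha : (1 - a ^ 2) / 2 ≠ 0) (x : Plane) :
    dartMap a ha x 1 = (1 - a ^ 2) / 2 + (1 - a ^ 2) / 2 * x 1 := by
  simp [dartMap]

theorem axisSimilarity_cornerMap (ha : 0 < a) : AxisSimilarity a 1 (cornerMap a ha.ne') := by
  have := axisSimilarity_swap.trans (axisSimilarity_scaling !₂[a, 1] (-a) (-a)
    (neg_ne_zero.2 ha.ne') (neg_ne_zero.2 ha.ne') Even.zero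
    (by rw [abs_neg, abs_of_pos ha]) (by rw [abs_neg, abs_of_pos ha]))
  rwa [mul_one] at this

theorem axisSimilarity_dartMap (ha : 0 < (1 - a ^ 2) / 2) {n : ℕ} (hn : Even n) :
    AxisSimilarity ((1 - a ^ 2) / 2) n (dartMap a ha.ne') :=
  axisSimilarity_scaling _ _ _ _ _ hn (abs_of_pos ha) (abs_of_pos ha)

theorem mem_cornerMap_openTriangle (ha : 0 < a) {x : Plane} :
    x ∈ cornerMap a ha.ne' '' openTriangle a ↔
      a < x 0 + a * x 1 ∧ a * x 0 + x 1 < 1 ∧ x 0 - a ^ 3 < a * x 1 := by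
  obtain ⟨y, rfl⟩ := (cornerMap a ha.ne').surjective x
  rw [(cornerMap a ha.ne').injective.mem_set_image, openTriangle, mem_ofPred_eq]
  simp only [cornerMap_zero, cornerMap_one]
  rw [← mul_lt_mul_iff_right₀ ha, ← mul_lt_mul_iff_right₀ (b := a) ha,
    ← mul_lt_mul_iff_right₀ (b := a * (y 0 - a)) ha]
  constructor <;> rintro ⟨h₁, h₂, h₃⟩ <;> refine ⟨?_, ?_, ?_⟩ <;> nlinarith

theorem mem_dartMap_openDart (ha : 0 < (1 - a ^ 2) / 2) {x : Plane} :
    x ∈ dartMap a ha.ne' '' openDart a ↔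
      a * (x 0 - a) + |x 1 - (1 - a ^ 2) / 2| < (1 - a ^ 2) / 2 ∧
        a * ((1 - a ^ 2) / 2) < x 0 - a + a * |x 1 - (1 - a ^ 2) / 2| := by
  obtain ⟨y, rfl⟩ := (dartMap a ha.ne').surjective x
  rw [(dartMap a ha.ne').injective.mem_set_image, openDart, mem_ofPred_eq]
  simp only [dartMap_zero, dartMap_one, add_sub_cancel_left, abs_mul, abs_of_pos ha]
  rw [← mul_lt_mul_iff_right₀ ha, ← mul_lt_mul_iff_right₀ (b := a) ha]
  ring_nf

/-- The largest vertical rhombus has its long diagonal on the line `x 0 = a`, from the vertex `(a,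
0)` up to the side `a * x 0 + x 1 = 1`. One of its edges lies along the side through `(0, 1)` and
`(a, 0)`, so exactly two pieces remain, one on each side of that line. -/
theorem children_triangle (ha : a ∈ Ioo (0 : ℝ) 1) (hσ : 0 < (1 - a ^ 2) / 2) :
    children a 1 (triangle a) =
      {cornerMap a ha.1.ne' '' triangle a, dartMap a hσ.ne' '' dart a} := by
  have ha' := ha
  obtain ⟨ha₀, ha₁⟩ := ha'
  have hmem : ∀ c : Plane, ∀ s > 0, ∀ x, x ∈ iterationRhombus a 1 c s ↔ _ :=
    fun c s hs x => mem_iterationRhombus_odd ha₀ odd_one hs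
  obtain ⟨σ, hσe⟩ : ∃ σ, σ = (1 - a ^ 2) / 2 := ⟨_, rfl⟩
  have hσ' : 0 < σ := hσe ▸ hσ
  have haσ := mul_pos ha₀ hσ'
  rw [children_eq_pieces (c₀ := !₂[a, (1 - a ^ 2) / 2]) hσ,
    pieces_eq_pair (U := cornerMap a ha.1.ne' '' openTriangle a)
    (V := dartMap a hσ.ne' '' openDart a) _ ((cornerMap a _).isOpenMap _ isOpen_openTriangle)
    ((dartMap a _).isOpenMap _ isOpen_openDart) _
    ((isPreconnected_openTriangle ha).image _ (cornerMap a _).continuous.continuousOn)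
    ((isPreconnected_openDart ha).image _ (dartMap a _).continuous.continuousOn)
    ((openTriangle_nonempty ha).image _)
    ((openDart_nonempty ha).image _), ← (cornerMap a _).image_closure,
    ← (dartMap a _).image_closure, closure_openTriangle ha, closure_openDart ha]
  · rw [interior_triangle ha]
    ext x
    rw [Set.mem_sdiff, hmem _ _ hσ, mem_union, mem_cornerMap_openTriangle ha₀,
      mem_dartMap_openDart hσ]
    simp only [openTriangle, mem_ofPred_eq]
    simp only [Matrix.cons_val_zero, Matrix.cons_val_one, ← hσe, not_le]
    have ha2 : a ^ 2 = 1 - 2 * σ := by linarith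
    have ha3 : a ^ 3 = a - 2 * (a * σ) := by rw [pow_succ, ha2]; ring
    rw [ha3]
    constructor
    · rintro ⟨⟨h₁, h₂, h₃⟩, h₄⟩
      rcases lt_or_ge (x 0) a with h | h
      · left
        refine ⟨h₂, h₁, ?_⟩
        rw [abs_of_neg (by linarith)] at h₄
        rcases abs_cases (x 1 - σ) with h | h <;> rw [h.1] at h₄ <;> nlinarith
      · right
        rw [abs_of_nonneg (by linarith)] at h₄
        refine ⟨?_, h₄⟩
        rcases abs_cases (x 1 - σ) with h | h <;> rw [h.1] <;> nlinarith
    · rintro (⟨h₁, h₂, h₃⟩ | ⟨h₁, h₂⟩)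
      · have h : x 0 < a := by
          by_contra hc
          push Not at hc
          nlinarith [mul_lt_mul_of_pos_left h₂ ha₀, mul_nonneg ha₀.le (sub_nonneg.2 hc)]
        refine ⟨⟨h₂, h₁, ?_⟩, ?_⟩
        · nlinarith
        · rw [abs_of_neg (by linarith)]
          nlinarith [mul_le_mul_of_nonneg_left (le_abs_self (x 1 - σ)) ha₀.le]
      · have h : a < x 0 := by
          by_contra hc
          push Not at hc
          nlinarith [mul_lt_mul_of_pos_left h₁ ha₀, mul_nonneg ha₀.le (sub_nonneg.2 hc)]
        rw [abs_of_pos (sub_pos.2 h)]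
        have h₃ := le_abs_self (x 1 - σ)
        have h₄ := neg_abs_le (x 1 - σ)
        refine ⟨⟨?_, ?_, ?_⟩, h₂⟩ <;> nlinarith
  · rw [Set.disjoint_left]
    rintro x h₁ h₂
    rw [mem_cornerMap_openTriangle ha₀] at h₁
    rw [mem_dartMap_openDart hσ, ← hσe] at h₂
    obtain ⟨h₁, h₂', h₃⟩ := h₁
    have h : x 0 < a := by
      by_contra hc
      push Not at hc
      nlinarith [mul_lt_mul_of_pos_left h₂' ha₀, mul_nonneg ha₀.le (sub_nonneg.2 hc)]
    nlinarith [mul_lt_mul_of_pos_left h₂.1 ha₀]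
  · intro x hx
    rw [hmem _ _ hσ] at hx
    simp only [Matrix.cons_val_zero, Matrix.cons_val_one, ← hσe] at hx
    have ha2 : a ^ 2 = 1 - 2 * σ := by linarith
    have h₁ := le_abs_self (x 0 - a)
    have h₂ := neg_abs_le (x 0 - a)
    have h₃ := le_abs_self (x 1 - σ)
    have h₄ := neg_abs_le (x 1 - σ)
    -- Since `a < 1`, the vertical rhombus lies in the horizontal one with the same centre and
    -- height; this settles the two sides of slopes `a` and `-a`.
    have h₅ : a * |x 0 - a| + |x 1 - σ| ≤ σ := by
      have : |x 1 - σ| * a ≤ (σ - a * |x 0 - a|) * a := by nlinarith [abs_nonneg (x 0 - a)]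
      linarith [le_of_mul_le_mul_right this ha₀]
    refine ⟨?_, ?_, ?_⟩ <;> nlinarith
  · intro c s hs' h
    have h₁ := @h !₂[c 0, c 1 + s] ((hmem _ _ hs' _).2 (by simp [abs_of_pos hs']))
    have h₂ := @h !₂[c 0, c 1 - s] ((hmem _ _ hs' _).2 (by simp [abs_of_pos hs']))
    simp only [triangle, mem_ofPred_eq] at h₁ h₂
    simp at h₁ h₂
    have e₁ : 2 * s ≤ 1 - a * c 0 - a * (c 0 - a) := by linarith [h₁.1, h₂.2.2]
    have e₂ : a * (2 * s) ≤ a - a ^ 2 * c 0 + c 0 - a := by nlinarith [h₁.1, h₂.2.1]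
    -- The vertical chord at abscissa `c 0` has length at least `2 * s`. Its bound `e₂` increases in
    -- `c 0`, its bound `e₁` decreases, and they cross at `c 0 = a`.
    have e₃ : s ≤ (1 - a ^ 2) / 2 := by
      rcases le_or_gt a (c 0) with hc | hc
      · nlinarith
      · refine le_of_mul_le_mul_left ?_ ha₀
        nlinarith
    refine ⟨e₃, fun e => ?_⟩
    have e₄ : c 0 = a := by
      rw [e] at e₁ e₂
      apply le_antisymm
      · by_contra hc
        push Not at hc
        nlinarith
      · by_contra hc
        push Not at hc
        nlinarith
    rw [e₄, e] at h₁ h₂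
    exact plane_ext (by simpa using e₄) (by simp; linarith [h₁.1, h₂.2.2])

end

/-! ### The coding map of a finite family of contractions -/

section Coding

variable {E ι : Type*} [MetricSpace E] [TopologicalSpace ι] [Finite ι]
  {ψ : ι → E → E} {κ : NNReal} {π : C(ℕ → ι, E)}

/-- The equation says that `π` is a fixed point of an operator on continuous maps, which contracts
by `κ` in the uniform metric. -/
theorem exists_coding [DiscreteTopology ι] [CompleteSpace E] [Nonempty E] (hκ : κ < 1)
    (hψ : ∀ i, LipschitzWith κ (ψ i)) :
    ∃ π : C(ℕ → ι, E), ∀ ω, π ω = ψ (ω 0) (π fun n => ω (n + 1)) := by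
  have hc : Continuous fun x : ι × E => ψ x.1 x.2 :=
    continuous_prod_of_discrete_left.2 fun i => (hψ i).continuous
  let T : C(ℕ → ι, E) → C(ℕ → ι, E) := fun π =>
    ⟨fun ω => ψ (ω 0) (π fun n => ω (n + 1)), by
      have h₀ : Continuous fun ω : ℕ → ι => ω 0 := continuous_apply 0
      have h₁ : Continuous fun ω : ℕ → ι => π fun n => ω (n + 1) := by fun_prop
      exact hc.comp (h₀.prodMk h₁)⟩
  have : Nonempty C(ℕ → ι, E) := ⟨.const _ (Classical.arbitrary E)⟩
  have hT : ContractingWith κ T := by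
    refine ⟨hκ, LipschitzWith.of_dist_le_mul fun π ρ => ?_⟩
    rw [ContinuousMap.dist_le (by positivity)]
    intro ω
    refine ((hψ (ω 0)).dist_le_mul _ _).trans ?_
    gcongr
    exact ContinuousMap.dist_apply_le_dist _
  exact ⟨hT.fixedPoint, fun ω => (DFunLike.congr_fun hT.fixedPoint_isFixedPt.eq ω).symm⟩

theorem exists_dist_le_of_continuousMap (π : C(ℕ → ι, E)) (x : E) : ∃ M, ∀ ω, dist (π ω) x ≤ M := by
  have : IsCompact (range fun ω => dist (π ω) x) := isCompact_range (by fun_prop)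
  obtain ⟨M, hM⟩ := this.bddAbove
  exact ⟨M, fun ω => hM ⟨ω, rfl⟩⟩

theorem mem_of_forall_exists_dist_le {S : Set E} (hS : IsClosed S) (hκ : κ < 1) {M : ℝ} {x : E}
    (h : ∀ n : ℕ, ∃ y ∈ S, dist x y ≤ κ ^ n * M) : x ∈ S := by
  rw [← hS.closure_eq, Metric.mem_closure_iff]
  intro ε hε
  have : Tendsto (fun n : ℕ => (κ : ℝ) ^ n * M) atTop (𝓝 (0 * M)) :=
    (tendsto_pow_atTop_nhds_zero_of_lt_one κ.2 hκ).mul_const M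
  rw [zero_mul] at this
  obtain ⟨n, hn⟩ := (this.eventually (gt_mem_nhds hε)).exists
  obtain ⟨y, hy, hxy⟩ := h n
  exact ⟨y, hy, hxy.trans_lt hn⟩

theorem coding_mem (hκ : κ < 1) (hψ : ∀ i, LipschitzWith κ (ψ i))
    (hπ : ∀ ω, π ω = ψ (ω 0) (π fun n => ω (n + 1))) {S : Set E} (hS : IsClosed S)
    (hn : S.Nonempty) (h : ∀ i, MapsTo (ψ i) S S) (ω : ℕ → ι) : π ω ∈ S := by
  obtain ⟨y₀, hy₀⟩ := hn
  obtain ⟨M, hM⟩ := exists_dist_le_of_continuousMap π y₀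
  refine mem_of_forall_exists_dist_le (M := M) hS hκ fun n => ?_
  induction n generalizing ω with
  | zero => exact ⟨y₀, hy₀, by simpa using hM ω⟩
  | succ n ih =>
    obtain ⟨y, hy, hd⟩ := ih fun n => ω (n + 1)
    refine ⟨ψ (ω 0) y, h _ hy, ?_⟩
    rw [hπ ω, pow_succ', mul_assoc]
    exact ((hψ _).dist_le_mul _ _).trans (by gcongr)

/-- Pulling a point back `n` times within `S` and replacing the last preimage by a coded point costs
at most `κ ^ n * M`; the range is compact, hence closed. -/
theorem subset_range_coding (hκ : κ < 1) (hψ : ∀ i, LipschitzWith κ (ψ i))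
    (hπ : ∀ ω, π ω = ψ (ω 0) (π fun n => ω (n + 1))) {S : Set E} {M : ℝ} (ω₀ : ℕ → ι)
    (hM : ∀ x ∈ S, dist x (π ω₀) ≤ M) (h : ∀ x ∈ S, ∃ i, ∃ y ∈ S, ψ i y = x) :
    S ⊆ range π := by
  intro x hx
  refine mem_of_forall_exists_dist_le (M := M) (isCompact_range π.continuous).isClosed hκ
    fun n => ?_
  induction n generalizing x with
  | zero => exact ⟨_, ⟨ω₀, rfl⟩, by simpa using hM x hx⟩
  | succ n ih =>
    obtain ⟨i, y, hy, rfl⟩ := h x hx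
    obtain ⟨_, ⟨ω, rfl⟩, hd⟩ := ih hy
    refine ⟨ψ i (π ω), ⟨fun n => Nat.casesOn n i ω, ?_⟩, ?_⟩
    · exact hπ _
    · rw [pow_succ', mul_assoc]
      exact ((hψ _).dist_le_mul _ _).trans (by gcongr)

end Coding

/-! ### The self-similar curve in the triangle -/

/-- The size `(1 - a ^ 2) / 2` of the dart that is a piece of `triangle a`, relative to `dart a`. -/
def dartRatio (a : ℝ) : ℝ := (1 - a ^ 2) / 2

theorem dartRatio_pos {a : ℝ} (ha : a ∈ Ioo (0 : ℝ) 1) : 0 < dartRatio a := by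
  have := ha.1; have := ha.2; unfold dartRatio; nlinarith

/-- The three similarities that take `triangle a` onto the triangles that arise from it. -/
def branch (a : ℝ) (ha : a ∈ Ioo (0 : ℝ) 1) : Fin 3 → Plane ≃ₜ Plane :=
  ![cornerMap a ha.1.ne', dartMap a (dartRatio_pos ha).ne',
    mirrorY.trans (dartMap a (dartRatio_pos ha).ne')]

/-- The ratios of the similarities `branch a`. -/
def ratio (a : ℝ) : Fin 3 → ℝ := ![a, dartRatio a, dartRatio a]

/-- The maps of the unit interval that correspond to `branch a`. -/
def clock (a s : ℝ) : Fin 3 → ℝ → ℝ :=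
  ![fun t => a ^ s * t, fun t => a ^ s + dartRatio a ^ s * t, fun t => 1 - dartRatio a ^ s * t]

section

variable {a s : ℝ} (ha : a ∈ Ioo (0 : ℝ) 1)

@[simp] theorem mirrorY_zero (x : Plane) : mirrorY x 0 = x 0 := by simp [mirrorY]
@[simp] theorem mirrorY_one (x : Plane) : mirrorY x 1 = -x 1 := by simp [mirrorY]
@[simp] theorem mirrorX_zero (x : Plane) : mirrorX x 0 = -x 0 := by simp [mirrorX]
@[simp] theorem mirrorX_one (x : Plane) : mirrorX x 1 = x 1 := by simp [mirrorX]

theorem branch_zero_zero (x : Plane) : branch a ha 0 x 0 = a - a * x 1 := by simp [branch]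
theorem branch_zero_one (x : Plane) : branch a ha 0 x 1 = 1 - a * x 0 := by simp [branch]
theorem branch_one_zero (x : Plane) : branch a ha 1 x 0 = a + dartRatio a * x 0 :=
  dartMap_zero (dartRatio_pos ha).ne' x
theorem branch_one_one (x : Plane) : branch a ha 1 x 1 = dartRatio a + dartRatio a * x 1 :=
  dartMap_one (dartRatio_pos ha).ne' x
theorem branch_two_zero (x : Plane) : branch a ha 2 x 0 = a + dartRatio a * x 0 :=
  (dartMap_zero (dartRatio_pos ha).ne' (mirrorY x)).trans (by simp [dartRatio])
theorem branch_two_one (x : Plane) : branch a ha 2 x 1 = dartRatio a - dartRatio a * x 1 :=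
  (dartMap_one (dartRatio_pos ha).ne' (mirrorY x)).trans (by simp [dartRatio, sub_eq_add_neg])

theorem exists_axisSimilarity_branch (i : Fin 3) :
    ∃ n, AxisSimilarity (ratio a i) n (branch a ha i) := by
  have h := axisSimilarity_dartMap (dartRatio_pos ha) Even.zero
  fin_cases i
  · exact ⟨1, axisSimilarity_cornerMap ha.1⟩
  · exact ⟨0, h⟩
  · refine ⟨0, ?_⟩
    have := (axisSimilarity_mirrorY Even.zero).trans h
    rwa [mul_one] at this

theorem ratio_pos (ha : a ∈ Ioo (0 : ℝ) 1) (i : Fin 3) : 0 < ratio a i :=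
  (exists_axisSimilarity_branch ha i).choose_spec.pos

theorem dist_branch (i : Fin 3) (x y : Plane) :
    dist (branch a ha i x) (branch a ha i y) = ratio a i * dist x y :=
  (exists_axisSimilarity_branch ha i).choose_spec.dist_eq x y

theorem dist_clock (ha : a ∈ Ioo (0 : ℝ) 1) (i : Fin 3) (t u : ℝ) :
    |clock a s i t - clock a s i u| = ratio a i ^ s * |t - u| := by
  rw [← abs_of_pos (Real.rpow_pos_of_pos (ratio_pos ha i) s), ← abs_mul]
  fin_cases i
  · simp [clock, ratio, mul_sub]
  · simp [clock, ratio, mul_sub]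
  · rw [← abs_neg]; simp [clock, ratio, mul_sub]

theorem ratio_lt_one (ha : a ∈ Ioo (0 : ℝ) 1) (i : Fin 3) : ratio a i < 1 := by
  have h : dartRatio a < 1 := by unfold dartRatio; nlinarith [sq_nonneg a]
  fin_cases i
  exacts [ha.2, h, h]

/-- Codings of the curve in `triangle a` and of the unit interval. -/
structure IsCoding (ha : a ∈ Ioo (0 : ℝ) 1) (s : ℝ) (π : C(ℕ → Fin 3, Plane))
    (τ : C(ℕ → Fin 3, ℝ)) : Prop where
  point_eq : ∀ ω, π ω = branch a ha (ω 0) (π fun n => ω (n + 1))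
  time_eq : ∀ ω, τ ω = clock a s (ω 0) (τ fun n => ω (n + 1))
  point_mem : ∀ ω, π ω ∈ triangle a
  time_mem : ∀ ω, τ ω ∈ Icc (0 : ℝ) 1
  range_time : Icc (0 : ℝ) 1 ⊆ range τ

theorem mapsTo_branch (i : Fin 3) : MapsTo (branch a ha i) (triangle a) (triangle a) := by
  rintro x ⟨h₁, h₂, h₃⟩
  have h₀ := ha.1
  have hσ := dartRatio_pos ha
  have e : a ^ 2 = 1 - 2 * dartRatio a := by unfold dartRatio; ring
  fin_cases i <;> simp only [triangle, mem_ofPred_eq]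
  · simp only [Fin.zero_eta, branch_zero_zero, branch_zero_one]
    refine ⟨?_, ?_, ?_⟩ <;> nlinarith
  · simp only [Fin.mk_one, branch_one_zero, branch_one_one]
    have : 0 ≤ x 1 := by nlinarith
    refine ⟨?_, ?_, ?_⟩ <;> nlinarith [mul_nonneg hσ.le this]
  · simp only [Fin.reduceFinMk, branch_two_zero, branch_two_one]
    have h₄ : 0 ≤ x 1 := by nlinarith
    have h₅ : 0 ≤ x 0 := by nlinarith [mul_le_mul_of_nonneg_left h₁ h₀.le]
    have h₆ : 0 ≤ x 0 + a - a * x 1 := by nlinarith [mul_le_mul_of_nonneg_left h₁ h₀.le]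
    refine ⟨?_, ?_, ?_⟩ <;> nlinarith [mul_nonneg hσ.le h₄, mul_nonneg hσ.le h₆]

theorem mapsTo_clock (ha : a ∈ Ioo (0 : ℝ) 1) (hs : a ^ s + 2 * dartRatio a ^ s = 1) (i : Fin 3) :
    MapsTo (clock a s i) (Icc 0 1) (Icc 0 1) := by
  rintro t ⟨h₀, h₁⟩
  have hp := Real.rpow_pos_of_pos ha.1 s
  have hq := Real.rpow_pos_of_pos (dartRatio_pos ha) s
  fin_cases i <;> simp only [clock] <;> simp <;> constructor <;> nlinarith

theorem exists_clock_eq (ha : a ∈ Ioo (0 : ℝ) 1) (hs : a ^ s + 2 * dartRatio a ^ s = 1) (t : ℝ)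
    (ht : t ∈ Icc (0 : ℝ) 1) : ∃ i, ∃ u ∈ Icc (0 : ℝ) 1, clock a s i u = t := by
  have hp := Real.rpow_pos_of_pos ha.1 s
  have hq := Real.rpow_pos_of_pos (dartRatio_pos ha) s
  obtain ⟨h₀, h₁⟩ := ht
  rcases le_total t (a ^ s) with h | h
  · refine ⟨0, t / a ^ s, ⟨by positivity, (div_le_one hp).2 h⟩, ?_⟩
    simp [clock]; field_simp
  rcases le_total t (1 - dartRatio a ^ s) with h' | h'
  · refine ⟨1, (t - a ^ s) / dartRatio a ^ s, ⟨div_nonneg (by linarith) hq.le,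
      (div_le_one hq).2 (by linarith)⟩, ?_⟩
    simp [clock]; field_simp; ring
  · refine ⟨2, (1 - t) / dartRatio a ^ s, ⟨div_nonneg (by linarith) hq.le,
      (div_le_one hq).2 (by linarith)⟩, ?_⟩
    simp [clock]; field_simp; ring

theorem exists_isCoding (hs₀ : 0 < s) (hs : a ^ s + 2 * dartRatio a ^ s = 1) :
    ∃ π τ, IsCoding ha s π τ := by
  obtain ⟨κ, hκ, hκi⟩ : ∃ κ : NNReal, κ < 1 ∧ ∀ i, ratio a i ≤ κ := by
    refine ⟨⟨max a (dartRatio a), ha.1.le.trans (le_max_left _ _)⟩,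
      max_lt ha.2 (ratio_lt_one ha 1), fun i => ?_⟩
    fin_cases i
    exacts [le_max_left _ _, le_max_right _ _, le_max_right _ _]
  obtain ⟨κ', hκ', hκi'⟩ : ∃ κ : NNReal, κ < 1 ∧ ∀ i, ratio a i ^ s ≤ κ :=
    ⟨κ ^ s, NNReal.rpow_lt_one hκ hs₀, fun i => by
      rw [NNReal.coe_rpow]
      exact Real.rpow_le_rpow (ratio_pos ha i).le (hκi i) hs₀.le⟩
  have hL : ∀ i, LipschitzWith κ (branch a ha i) := fun i =>
    LipschitzWith.of_dist_le_mul fun x y => by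
      rw [dist_branch]; exact mul_le_mul_of_nonneg_right (hκi i) dist_nonneg
  have hL' : ∀ i, LipschitzWith κ' (clock a s i) := fun i =>
    LipschitzWith.of_dist_le_mul fun x y => by
      rw [Real.dist_eq, Real.dist_eq, dist_clock ha]
      exact mul_le_mul_of_nonneg_right (hκi' i) (abs_nonneg _)
  obtain ⟨π, hπ⟩ := exists_coding hκ hL
  obtain ⟨τ, hτ⟩ := exists_coding hκ' hL'
  have hm := coding_mem hκ' hL' hτ isClosed_Icc ⟨0, left_mem_Icc.2 zero_le_one⟩
    (mapsTo_clock ha hs)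
  refine ⟨π, τ, hπ, hτ, coding_mem hκ hL hπ isClosed_triangle
    ((openTriangle_nonempty ha).mono openTriangle_subset) (mapsTo_branch ha), hm, ?_⟩
  exact subset_range_coding hκ' hL' hτ (M := 1) (fun _ => 0)
    (fun x hx => by
      have := hm fun _ => 0
      rw [Real.dist_eq, abs_le]
      constructor <;> linarith [hx.1, hx.2, this.1, this.2])
    (exists_clock_eq ha hs)

end

/-! ### The codings of the curve and of the interval are comparable -/

/-- The numbers `x` and `y` agree up to the factor `C`. -/
def Comparable (C x y : ℝ) : Prop := x ≤ C * y ∧ y ≤ C * x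

theorem Comparable.mono {C C' x y : ℝ} (h : Comparable C x y) (hC : C ≤ C') (hx : 0 ≤ x)
    (hy : 0 ≤ y) : Comparable C' x y :=
  ⟨h.1.trans (mul_le_mul_of_nonneg_right hC hy), h.2.trans (mul_le_mul_of_nonneg_right hC hx)⟩

theorem Comparable.mul_left {C x y c : ℝ} (h : Comparable C x y) (hc : 0 ≤ c) :
    Comparable C (c * x) (c * y) :=
  ⟨by nlinarith [mul_le_mul_of_nonneg_left h.1 hc], by nlinarith [mul_le_mul_of_nonneg_left h.2 hc]⟩

/-- For pairs at a definite distance, there is nothing to compare beyond the bounds themselves. -/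
theorem comparable_rpow_of_bounds {d t δ M c s : ℝ} (hs : 0 < s) (hδ : 0 < δ) (hc : 0 < c)
    (h₁ : δ ≤ d) (h₂ : d ≤ M) (h₃ : c ≤ t) (h₄ : t ≤ 1) :
    Comparable (M ^ s / c + 1 / δ ^ s) (d ^ s) t := by
  have hd : 0 < d := hδ.trans_le h₁
  have hM : 0 < M := hd.trans_le h₂
  have e₁ : d ^ s ≤ M ^ s := Real.rpow_le_rpow hd.le h₂ hs.le
  have e₂ : δ ^ s ≤ d ^ s := Real.rpow_le_rpow hδ.le h₁ hs.le
  have hδs := Real.rpow_pos_of_pos hδ s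
  have hds := Real.rpow_pos_of_pos hd s
  have hMs := Real.rpow_pos_of_pos hM s
  constructor
  · calc d ^ s ≤ M ^ s / c * c := by rwa [div_mul_cancel₀ _ hc.ne']
      _ ≤ (M ^ s / c + 1 / δ ^ s) * t := by gcongr; simp; positivity
  · calc t ≤ 1 / δ ^ s * δ ^ s := by rwa [div_mul_cancel₀ _ hδs.ne']
      _ ≤ (M ^ s / c + 1 / δ ^ s) * d ^ s := by gcongr; simp; positivity

/-- For two points on either side of a junction: `d₁` and `d₂` are their distances to the junction,
and the times to it add up exactly. -/
theorem comparable_rpow_add {d d₁ d₂ t₁ t₂ C κ s : ℝ} (hs : 0 < s) (hC : 0 ≤ C) (hκ : 0 ≤ κ)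
    (hd : 0 ≤ d) (hd₁ : 0 ≤ d₁) (hd₂ : 0 ≤ d₂) (h : d ≤ d₁ + d₂) (h₁ : d₁ ≤ κ * d)
    (h₂ : d₂ ≤ κ * d) (hc₁ : Comparable C (d₁ ^ s) t₁) (hc₂ : Comparable C (d₂ ^ s) t₂) :
    Comparable (C * (2 ^ s + 2 * κ ^ s)) (d ^ s) (t₁ + t₂) := by
  have e₁ : d ^ s ≤ 2 ^ s * (d₁ ^ s + d₂ ^ s) := by
    have p₁ := Real.rpow_nonneg hd₁ s
    have p₂ := Real.rpow_nonneg hd₂ s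
    have p₃ : (0 : ℝ) ≤ 2 ^ s := by positivity
    rcases le_total d₁ d₂ with h' | h'
    · calc d ^ s ≤ (2 * d₂) ^ s := Real.rpow_le_rpow hd (by linarith) hs.le
        _ = 2 ^ s * d₂ ^ s := Real.mul_rpow (by norm_num) hd₂
        _ ≤ _ := by gcongr; linarith
    · calc d ^ s ≤ (2 * d₁) ^ s := Real.rpow_le_rpow hd (by linarith) hs.le
        _ = 2 ^ s * d₁ ^ s := Real.mul_rpow (by norm_num) hd₁
        _ ≤ _ := by gcongr; linarith
  have e₂ : d₁ ^ s ≤ κ ^ s * d ^ s := by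
    rw [← Real.mul_rpow hκ hd]; exact Real.rpow_le_rpow hd₁ h₁ hs.le
  have e₃ : d₂ ^ s ≤ κ ^ s * d ^ s := by
    rw [← Real.mul_rpow hκ hd]; exact Real.rpow_le_rpow hd₂ h₂ hs.le
  have q₁ : (0 : ℝ) ≤ 2 ^ s := by positivity
  have q₂ : 0 ≤ κ ^ s := Real.rpow_nonneg hκ s
  have q₃ : 0 ≤ d ^ s := Real.rpow_nonneg hd s
  have t₁0 : 0 ≤ C * t₁ := (Real.rpow_nonneg hd₁ s).trans hc₁.1
  have t₂0 : 0 ≤ C * t₂ := (Real.rpow_nonneg hd₂ s).trans hc₂.1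
  constructor
  · calc d ^ s ≤ 2 ^ s * (d₁ ^ s + d₂ ^ s) := e₁
      _ ≤ 2 ^ s * (C * t₁ + C * t₂) := by gcongr; exacts [hc₁.1, hc₂.1]
      _ ≤ _ := by nlinarith [mul_nonneg q₂ t₁0, mul_nonneg q₂ t₂0]
  · calc t₁ + t₂ ≤ C * (κ ^ s * d ^ s) + C * (κ ^ s * d ^ s) := by
          refine add_le_add (hc₁.2.trans ?_) (hc₂.2.trans ?_) <;> gcongr
      _ ≤ _ := by nlinarith [mul_nonneg hC (mul_nonneg q₁ q₃)]

section

variable {a s : ℝ}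

/-- The sides at `(0, 1)` have slopes `-a` and `-1 / a`, so the triangle lies in a cone there that
avoids the vertical direction. -/
theorem dist_le_of_mem_triangle_left (ha : a ∈ Ioo (0 : ℝ) 1) {x : Plane} (hx : x ∈ triangle a) :
    0 ≤ x 0 ∧ dist x !₂[0, 1] ≤ (1 + 1 / a) * x 0 := by
  obtain ⟨h₁, h₂, h₃⟩ := hx
  obtain ⟨ha₀, ha₁⟩ := ha
  have ha₂ : 0 < 1 - a ^ 2 := by nlinarith
  have h₀ : 0 ≤ x 0 := by
    by_contra hc
    push Not at hc
    nlinarith [mul_le_mul_of_nonneg_left h₁ ha₀.le, mul_pos (neg_pos.2 hc) ha₂]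
  refine ⟨h₀, (dist_le_abs_add_abs _ _).trans ?_⟩
  have : |x 1 - 1| ≤ x 0 / a := by
    rw [abs_le, ← neg_div, div_le_iff₀ ha₀, le_div_iff₀ ha₀]
    constructor <;> nlinarith [mul_le_mul_of_nonneg_left h₁ ha₀.le, mul_nonneg (sq_nonneg a) h₀]
  rw [show (1 + 1 / a) * x 0 = x 0 + x 0 / a by ring]
  refine add_le_add ?_ (by simpa using this)
  simp [abs_of_nonneg h₀]

theorem dist_le_of_mem_triangle_bottom (ha : a ∈ Ioo (0 : ℝ) 1) {x : Plane}
    (hx : x ∈ triangle a) : 0 ≤ x 1 ∧ dist x !₂[a, 0] ≤ (1 + 1 / a) * x 1 := by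
  obtain ⟨h₁, h₂, h₃⟩ := hx
  obtain ⟨ha₀, ha₁⟩ := ha
  have ha₂ : 0 < 1 - a ^ 2 := by nlinarith
  have h₀ : 0 ≤ x 1 := by
    by_contra hc
    push Not at hc
    nlinarith [mul_le_mul_of_nonneg_left h₂ ha₀.le, mul_nonneg (sq_nonneg a) (neg_pos.2 hc).le]
  refine ⟨h₀, (dist_le_abs_add_abs _ _).trans ?_⟩
  have : |x 0 - a| ≤ x 1 / a := by
    rw [abs_le, ← neg_div, div_le_iff₀ ha₀, le_div_iff₀ ha₀]
    constructor <;> nlinarith [mul_le_mul_of_nonneg_left h₂ ha₀.le, mul_nonneg ha₂.le h₀]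
  rw [show (1 + 1 / a) * x 1 = x 1 / a + x 1 by ring]
  refine add_le_add (by simpa using this) ?_
  simp [abs_of_nonneg h₀]

theorem triangle_height_le {x : Plane} (hx : x ∈ triangle a) :
    a * x 0 ≤ 1 - dartRatio a := by
  have := hx.1; have := hx.2.2; unfold dartRatio; nlinarith

variable {ha : a ∈ Ioo (0 : ℝ) 1} {π : C(ℕ → Fin 3, Plane)} {τ : C(ℕ → Fin 3, ℝ)}

theorem exponent_pos (ha : a ∈ Ioo (0 : ℝ) 1) (hs : a ^ s + 2 * dartRatio a ^ s = 1) : 0 < s := by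
  by_contra hc
  push Not at hc
  have h₁ := Real.one_le_rpow_of_pos_of_le_one_of_nonpos ha.1 ha.2.le hc
  have h₂ := Real.rpow_pos_of_pos (dartRatio_pos ha) s
  linarith

theorem IsCoding.zero_point (h : IsCoding ha s π τ) : π (fun _ => 0) = !₂[0, 1] := by
  have h₁ := h.point_eq fun _ => 0
  have h₂ : branch a ha 0 !₂[0, 1] = !₂[0, 1] :=
    plane_ext (by rw [branch_zero_zero]; simp) (by rw [branch_zero_one]; simp)
  have h₃ := dist_branch ha 0 (π fun _ => 0) !₂[0, 1]
  rw [← h₁, h₂] at h₃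
  have h₄ : ratio a 0 = a := rfl
  rw [h₄] at h₃
  rw [← dist_le_zero]
  by_contra hc
  push Not at hc
  nlinarith [ha.2]

theorem IsCoding.zero_time (h : IsCoding ha s π τ) (hs : a ^ s + 2 * dartRatio a ^ s = 1) :
    τ (fun _ => 0) = 0 := by
  have h₁ := h.time_eq fun _ => 0
  have h₂ := Real.rpow_pos_of_pos (dartRatio_pos ha) s
  simp only [clock, Matrix.cons_val_zero] at h₁
  have : (1 - a ^ s) * τ (fun _ => 0) = 0 := by linarith
  exact (mul_eq_zero.1 this).resolve_left (by linarith)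

theorem clock_zero (t : ℝ) : clock a s 0 t = a ^ s * t := rfl
theorem clock_one (t : ℝ) : clock a s 1 t = a ^ s + dartRatio a ^ s * t := rfl
theorem clock_two (t : ℝ) : clock a s 2 t = 1 - dartRatio a ^ s * t := rfl

theorem rpow_dist_branch (i : Fin 3) (x y : Plane) :
    dist (branch a ha i x) (branch a ha i y) ^ s = ratio a i ^ s * dist x y ^ s := by
  rw [dist_branch, Real.mul_rpow (ratio_pos ha i).le dist_nonneg]

/-- The curve runs from `(0, 1)` to `(a, 0)`. This and the next four identities join the branches
end to end; the last branch is traversed backwards, which is why its clock decreases. -/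
theorem branch_left : branch a ha 0 !₂[0, 1] = !₂[0, 1] :=
  plane_ext (by rw [branch_zero_zero]; simp) (by rw [branch_zero_one]; simp)

theorem branch_zero_bottom : branch a ha 0 !₂[a, 0] = !₂[a, 2 * dartRatio a] :=
  plane_ext (by rw [branch_zero_zero]; simp)
    (by simp [branch_zero_one, dartRatio]; ring)

theorem branch_one_left : branch a ha 1 !₂[0, 1] = !₂[a, 2 * dartRatio a] :=
  plane_ext (by rw [branch_one_zero]; simp)
    (by rw [branch_one_one]; simp; ring)

theorem branch_one_bottom : branch a ha 1 !₂[a, 0] = branch a ha 2 !₂[a, 0] :=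
  plane_ext (by rw [branch_one_zero, branch_two_zero])
    (by rw [branch_one_one, branch_two_one]; simp)

theorem branch_two_left : branch a ha 2 !₂[0, 1] = !₂[a, 0] :=
  plane_ext (by rw [branch_two_zero]; simp) (by rw [branch_two_one]; simp)

theorem le_zero_of_mem_triangle (i : Fin 3) (hi : i ≠ 0) {x : Plane} (hx : x ∈ triangle a) :
    a ≤ branch a ha i x 0 := by
  have h₀ := (dist_le_of_mem_triangle_left ha hx).1
  have hσ := mul_nonneg (dartRatio_pos ha).le h₀
  fin_cases i
  · exact absurd rfl hi
  · exact (branch_one_zero ha x).symm ▸ by linarith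
  · exact (branch_two_zero ha x).symm ▸ by linarith

theorem le_one_of_mem_triangle (i : Fin 3) (hi : i ≠ 2) {x : Plane} (hx : x ∈ triangle a) :
    dartRatio a ≤ branch a ha i x 1 := by
  have h₀ := (dist_le_of_mem_triangle_bottom ha hx).1
  have hσ := mul_nonneg (dartRatio_pos ha).le h₀
  have h₁ := triangle_height_le hx
  fin_cases i
  · exact (branch_zero_one ha x).symm ▸ by linarith
  · exact (branch_one_one ha x).symm ▸ by linarith
  · exact absurd rfl hi

/-- Branch `0` fixes the starting point and scales both quantities by `a ^ s`. Stripping leading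
zeros reduces to a nonzero first letter, where the abscissa is at least `a` and the time at least `a
^ s`. -/
theorem IsCoding.exists_comparable_left (h : IsCoding ha s π τ)
    (hs : a ^ s + 2 * dartRatio a ^ s = 1) :
    ∃ C, 0 ≤ C ∧ ∀ ω, Comparable C (dist (π ω) !₂[0, 1] ^ s) (τ ω) := by
  have hs₀ := exponent_pos ha hs
  have hp := Real.rpow_pos_of_pos ha.1 s
  have hq := Real.rpow_pos_of_pos (dartRatio_pos ha) s
  obtain ⟨M, hM⟩ := exists_dist_le_of_continuousMap π !₂[0, 1]
  have hM0 : 0 ≤ M := dist_nonneg.trans (hM fun _ => 0)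
  refine ⟨M ^ s / a ^ s + 1 / a ^ s, by positivity, ?_⟩
  have base : ∀ ω : ℕ → Fin 3, ω 0 ≠ 0 →
      Comparable (M ^ s / a ^ s + 1 / a ^ s) (dist (π ω) !₂[0, 1] ^ s) (τ ω) := by
    intro ω hω
    refine comparable_rpow_of_bounds hs₀ ha.1 hp ?_ (hM ω) ?_ (h.time_mem ω).2
    · have h₁ := le_zero_of_mem_triangle (ha := ha) (ω 0) hω (h.point_mem fun n => ω (n + 1))
      rw [← h.point_eq] at h₁
      refine le_trans ?_ (abs_sub_zero_le_dist _ _)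
      simpa using h₁.trans (le_abs_self _)
    · have h₁ := h.time_mem fun n => ω (n + 1)
      rw [h.time_eq]
      rcases (by omega : ω 0 = 1 ∨ ω 0 = 2) with e | e <;> rw [e]
      · rw [clock_one]; nlinarith [h₁.1]
      · rw [clock_two]; nlinarith [h₁.2]
  have key : ∀ n : ℕ, ∀ ω : ℕ → Fin 3, ω n ≠ 0 →
      Comparable (M ^ s / a ^ s + 1 / a ^ s) (dist (π ω) !₂[0, 1] ^ s) (τ ω) := by
    intro n
    induction n with
    | zero => exact base
    | succ n ih =>
      intro ω hω
      by_cases h0 : ω 0 = 0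
      · have := (ih (fun n => ω (n + 1)) hω).mul_left hp.le
        rw [h.point_eq ω, h.time_eq ω, h0, clock_zero]
        rw [← branch_left (ha := ha), rpow_dist_branch]
        exact this
      · exact base ω h0
  intro ω
  by_cases h0 : ∃ n, ω n ≠ 0
  · exact key _ ω h0.choose_spec
  · push Not at h0
    obtain rfl : ω = fun _ => 0 := funext h0
    rw [h.zero_point, h.zero_time hs, dist_self, Real.zero_rpow hs₀.ne']
    simp [Comparable]

theorem IsCoding.exists_comparable_bottom (h : IsCoding ha s π τ)
    (hs : a ^ s + 2 * dartRatio a ^ s = 1) :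
    ∃ C, 0 ≤ C ∧ ∀ ω, Comparable C (dist (π ω) !₂[a, 0] ^ s) (1 - τ ω) := by
  have hs₀ := exponent_pos ha hs
  have hp := Real.rpow_pos_of_pos ha.1 s
  have hq := Real.rpow_pos_of_pos (dartRatio_pos ha) s
  obtain ⟨M, hM⟩ := exists_dist_le_of_continuousMap π !₂[a, 0]
  have hM0 : 0 ≤ M := dist_nonneg.trans (hM fun _ => 0)
  obtain ⟨C, hC, hCl⟩ := h.exists_comparable_left hs
  set q := dartRatio a ^ s
  refine ⟨C + (M ^ s / q + 1 / q), by positivity, fun ω => ?_⟩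
  have hd : 0 ≤ dist (π ω) !₂[a, 0] ^ s := by positivity
  have ht : 0 ≤ 1 - τ ω := sub_nonneg.2 (h.time_mem ω).2
  -- Only branch `2` reaches the end point, and it sends the starting point there, so the previous
  -- comparison applies after one step. The other branches stay at height at least `dartRatio a`.
  by_cases h2 : ω 0 = 2
  · refine Comparable.mono ?_ (le_add_of_nonneg_right (by positivity)) hd ht
    have := (hCl (fun n => ω (n + 1))).mul_left hq.le
    rw [h.point_eq ω, h.time_eq ω, h2, clock_two, sub_sub_cancel]
    rw [← branch_two_left (ha := ha), rpow_dist_branch]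
    exact this
  · refine Comparable.mono ?_ (le_add_of_nonneg_left hC) hd ht
    refine comparable_rpow_of_bounds hs₀ (dartRatio_pos ha) hq ?_ (hM ω) ?_
      (by linarith [(h.time_mem ω).1])
    · have h₁ := le_one_of_mem_triangle (ha := ha) (ω 0) h2 (h.point_mem fun n => ω (n + 1))
      rw [← h.point_eq] at h₁
      refine le_trans ?_ (abs_sub_one_le_dist _ _)
      simpa using h₁.trans (le_abs_self _)
    · have h₁ := h.time_mem fun n => ω (n + 1)
      rw [h.time_eq]
      rcases (by omega : ω 0 = 0 ∨ ω 0 = 1) with e | e <;> rw [e]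
      · rw [clock_zero]; nlinarith [h₁.2]
      · rw [clock_one]; nlinarith [h₁.2]

/-- The line `x 0 = a` separates the two branches, and by the cone estimates the distance of a point
to the junction is controlled by its distance to that line. -/
theorem dist_branch_zero_one {x y : Plane} (hx : x ∈ triangle a) (hy : y ∈ triangle a) :
    dist (branch a ha 0 x) !₂[a, 2 * dartRatio a] ≤
        (1 + 1 / a) * dist (branch a ha 0 x) (branch a ha 1 y) ∧
      dist (branch a ha 1 y) !₂[a, 2 * dartRatio a] ≤
        (1 + 1 / a) * dist (branch a ha 0 x) (branch a ha 1 y) := by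
  obtain ⟨hx₀, hx₁⟩ := dist_le_of_mem_triangle_bottom ha hx
  obtain ⟨hy₀, hy₁⟩ := dist_le_of_mem_triangle_left ha hy
  have hσ := dartRatio_pos ha
  have h₁ := (neg_abs_le _).trans' (neg_le_neg
    (abs_sub_zero_le_dist (branch a ha 0 x) (branch a ha 1 y)))
  rw [branch_zero_zero, branch_one_zero] at h₁
  have ha₀ := ha.1
  have hκ : 0 ≤ 1 + 1 / a := by positivity
  have e₁ := mul_nonneg ha₀.le hx₀
  have e₂ := mul_nonneg hσ.le hy₀
  constructor
  · rw [← branch_zero_bottom (ha := ha), dist_branch]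
    calc a * dist x !₂[a, 0] ≤ a * ((1 + 1 / a) * x 1) := by gcongr
      _ = (1 + 1 / a) * (a * x 1) := by ring
      _ ≤ _ := by gcongr; linarith
  · rw [← branch_one_left (ha := ha), dist_branch]
    calc dartRatio a * dist y !₂[0, 1] ≤ dartRatio a * ((1 + 1 / a) * y 0) := by gcongr
      _ = (1 + 1 / a) * (dartRatio a * y 0) := by ring
      _ ≤ _ := by gcongr; linarith

/-- Here the separating line is the horizontal one at height `dartRatio a`, the symmetry axis of the
dart. -/
theorem dist_branch_one_two {x y : Plane} (hx : x ∈ triangle a) (hy : y ∈ triangle a) :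
    dist (branch a ha 1 x) (branch a ha 1 !₂[a, 0]) ≤
        (1 + 1 / a) * dist (branch a ha 1 x) (branch a ha 2 y) ∧
      dist (branch a ha 2 y) (branch a ha 1 !₂[a, 0]) ≤
        (1 + 1 / a) * dist (branch a ha 1 x) (branch a ha 2 y) := by
  obtain ⟨hx₀, hx₁⟩ := dist_le_of_mem_triangle_bottom ha hx
  obtain ⟨hy₀, hy₁⟩ := dist_le_of_mem_triangle_bottom ha hy
  have hσ := dartRatio_pos ha
  have h₁ := (le_abs_self _).trans (abs_sub_one_le_dist (branch a ha 1 x) (branch a ha 2 y))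
  rw [branch_one_one, branch_two_one] at h₁
  have ha₀ := ha.1
  have hκ : 0 ≤ 1 + 1 / a := by positivity
  have e₁ := mul_nonneg hσ.le hx₀
  have e₂ := mul_nonneg hσ.le hy₀
  constructor
  · rw [dist_branch]
    calc dartRatio a * dist x !₂[a, 0] ≤ dartRatio a * ((1 + 1 / a) * x 1) := by gcongr
      _ = (1 + 1 / a) * (dartRatio a * x 1) := by ring
      _ ≤ _ := by gcongr; linarith
  · rw [branch_one_bottom, dist_branch]
    calc dartRatio a * dist y !₂[a, 0] ≤ dartRatio a * ((1 + 1 / a) * y 1) := by gcongr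
      _ = (1 + 1 / a) * (dartRatio a * y 1) := by ring
      _ ≤ _ := by gcongr; linarith

theorem le_dist_branch_zero_two {x y : Plane} (hx : x ∈ triangle a) (hy : y ∈ triangle a) :
    a * dartRatio a / 2 ≤ dist (branch a ha 0 x) (branch a ha 2 y) := by
  obtain ⟨hx₀, hx₁⟩ := dist_le_of_mem_triangle_bottom ha hx
  obtain ⟨hy₀, hy₁⟩ := dist_le_of_mem_triangle_bottom ha hy
  obtain ⟨hz₀, hz₁⟩ := dist_le_of_mem_triangle_left ha hy
  have ha₀ := ha.1
  have ha₁ := ha.2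
  have hσ := dartRatio_pos ha
  have e₁ := mul_nonneg hσ.le hy₀
  have e₂ := mul_nonneg hσ.le hz₀
  -- For large `x 1` the first branch is well to the left of `x 0 = a`; for small `x 1` its image is
  -- near the upper junction, well above the last branch.
  rcases le_total (dartRatio a / 2) (x 1) with h | h
  · have h₁ := (neg_abs_le _).trans' (neg_le_neg
      (abs_sub_zero_le_dist (branch a ha 0 x) (branch a ha 2 y)))
    rw [branch_zero_zero, branch_two_zero] at h₁
    nlinarith
  · have h₁ := (le_abs_self _).trans (abs_sub_one_le_dist (branch a ha 0 x) (branch a ha 2 y))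
    rw [branch_zero_one, branch_two_one] at h₁
    have h₂ : a ^ 2 = 1 - 2 * dartRatio a := by unfold dartRatio; ring
    have h₃ := hx.2.2
    nlinarith

theorem IsCoding.exists_comparable_of_lt (h : IsCoding ha s π τ)
    (hs : a ^ s + 2 * dartRatio a ^ s = 1) :
    ∃ C, 0 ≤ C ∧ ∀ ω ω' : ℕ → Fin 3, ω 0 < ω' 0 →
      Comparable C (dist (π ω) (π ω') ^ s) |τ ω - τ ω'| := by
  have hs₀ := exponent_pos ha hs
  have hp := Real.rpow_pos_of_pos ha.1 s
  have hσ := dartRatio_pos ha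
  have ha₀ := ha.1
  have hq := Real.rpow_pos_of_pos hσ s
  obtain ⟨M, hM⟩ := exists_dist_le_of_continuousMap π (π fun _ => 0)
  have hM' : ∀ ω ω', dist (π ω) (π ω') ≤ M + M := fun ω ω' =>
    (dist_triangle_right _ _ _).trans (add_le_add (hM ω) (hM ω'))
  have hM0 : 0 ≤ M := dist_nonneg.trans (hM fun _ => 0)
  obtain ⟨Cl, hCl0, hCl⟩ := h.exists_comparable_left hs
  obtain ⟨Cb, hCb0, hCb⟩ := h.exists_comparable_bottom hs
  have hκ : 0 ≤ 1 + 1 / a := by positivity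
  refine ⟨(Cl + Cb) * (2 ^ s + 2 * (1 + 1 / a) ^ s) +
    ((M + M) ^ s / dartRatio a ^ s + 1 / (a * dartRatio a / 2) ^ s), by positivity,
    fun ω ω' hlt => ?_⟩
  have hd : 0 ≤ dist (π ω) (π ω') ^ s := by positivity
  have hx := h.point_mem fun n => ω (n + 1)
  have hy := h.point_mem fun n => ω' (n + 1)
  have ht := h.time_mem fun n => ω (n + 1)
  have hu := h.time_mem fun n => ω' (n + 1)
  have hCl' : ∀ ω, Comparable (Cl + Cb) (dist (π ω) !₂[0, 1] ^ s) (τ ω) := fun ω =>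
    (hCl ω).mono (le_add_of_nonneg_right hCb0) (by positivity) (h.time_mem ω).1
  have hCb' : ∀ ω, Comparable (Cl + Cb) (dist (π ω) !₂[a, 0] ^ s) (1 - τ ω) := fun ω =>
    (hCb ω).mono (le_add_of_nonneg_left hCl0) (by positivity) (sub_nonneg.2 (h.time_mem ω).2)
  rcases (by omega : ω 0 = 0 ∧ ω' 0 = 1 ∨ ω 0 = 1 ∧ ω' 0 = 2 ∨ ω 0 = 0 ∧ ω' 0 = 2) with
    ⟨e, e'⟩ | ⟨e, e'⟩ | ⟨e, e'⟩
  · refine Comparable.mono ?_ (le_add_of_nonneg_right (by positivity)) hd (abs_nonneg _)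
    rw [h.point_eq ω, h.point_eq ω', h.time_eq ω, h.time_eq ω', e, e', clock_zero, clock_one]
    rw [show ∀ p q t u : ℝ, p * t - (p + q * u) = -(p * (1 - t) + q * u) by intros; ring, abs_neg,
      abs_of_nonneg (add_nonneg (mul_nonneg hp.le (sub_nonneg.2 ht.2)) (mul_nonneg hq.le hu.1))]
    obtain ⟨h₁, h₂⟩ := dist_branch_zero_one (ha := ha) hx hy
    refine comparable_rpow_add hs₀ (by positivity) hκ dist_nonneg dist_nonneg dist_nonneg
      (dist_triangle_right _ _ _) h₁ h₂ ?_ ?_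
    · rw [← branch_zero_bottom (ha := ha), rpow_dist_branch]
      exact (hCb' _).mul_left hp.le
    · rw [← branch_one_left (ha := ha), rpow_dist_branch]
      exact (hCl' _).mul_left hq.le
  · refine Comparable.mono ?_ (le_add_of_nonneg_right (by positivity)) hd (abs_nonneg _)
    rw [h.point_eq ω, h.point_eq ω', h.time_eq ω, h.time_eq ω', e, e', clock_one, clock_two]
    have e₁ : ∀ t u : ℝ, a ^ s + dartRatio a ^ s * t - (1 - dartRatio a ^ s * u) =
        -(dartRatio a ^ s * (1 - t) + dartRatio a ^ s * (1 - u)) := by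
      intros; linear_combination hs
    rw [e₁, abs_neg, abs_of_nonneg (add_nonneg (mul_nonneg hq.le (sub_nonneg.2 ht.2))
      (mul_nonneg hq.le (sub_nonneg.2 hu.2)))]
    obtain ⟨h₁, h₂⟩ := dist_branch_one_two (ha := ha) hx hy
    refine comparable_rpow_add hs₀ (by positivity) hκ dist_nonneg dist_nonneg dist_nonneg
      (dist_triangle_right _ _ _) h₁ h₂ ?_ ?_
    · rw [rpow_dist_branch]
      exact (hCb' _).mul_left hq.le
    · rw [branch_one_bottom, rpow_dist_branch]
      exact (hCb' _).mul_left hq.le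
  · refine Comparable.mono ?_ (le_add_of_nonneg_left (by positivity)) hd (abs_nonneg _)
    refine comparable_rpow_of_bounds hs₀ (by positivity) hq ?_ (hM' ω ω') ?_ ?_
    · rw [h.point_eq ω, h.point_eq ω', e, e']
      exact le_dist_branch_zero_two hx hy
    · rw [h.time_eq ω, h.time_eq ω', e, e', clock_zero, clock_two]
      refine le_trans ?_ (neg_le_abs _)
      nlinarith [ht.2, hu.2]
    · rw [abs_le]
      constructor <;> linarith [(h.time_mem ω).1, (h.time_mem ω).2, (h.time_mem ω').1,
        (h.time_mem ω').2]

/-- A common first letter multiplies both quantities by the same factor, so the constant for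
sequences that differ at once serves for all. -/
theorem IsCoding.exists_comparable (h : IsCoding ha s π τ)
    (hs : a ^ s + 2 * dartRatio a ^ s = 1) :
    ∃ C, 0 ≤ C ∧ ∀ ω ω' : ℕ → Fin 3, Comparable C (dist (π ω) (π ω') ^ s) |τ ω - τ ω'| := by
  have hs₀ := exponent_pos ha hs
  obtain ⟨C, hC, hlt⟩ := h.exists_comparable_of_lt hs
  have base : ∀ ω ω' : ℕ → Fin 3, ω 0 ≠ ω' 0 →
      Comparable C (dist (π ω) (π ω') ^ s) |τ ω - τ ω'| := by
    intro ω ω' hne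
    rcases lt_or_gt_of_ne hne with h' | h'
    · exact hlt ω ω' h'
    · rw [dist_comm, abs_sub_comm]; exact hlt ω' ω h'
  have key : ∀ n : ℕ, ∀ ω ω' : ℕ → Fin 3, ω n ≠ ω' n →
      Comparable C (dist (π ω) (π ω') ^ s) |τ ω - τ ω'| := by
    intro n
    induction n with
    | zero => exact base
    | succ n ih =>
      intro ω ω' hne
      by_cases h0 : ω 0 = ω' 0
      · rw [h.point_eq ω, h.point_eq ω', h.time_eq ω, h.time_eq ω', ← h0, rpow_dist_branch,
          dist_clock ha]
        exact (ih (fun n => ω (n + 1)) (fun n => ω' (n + 1)) hne).mul_left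
          (Real.rpow_nonneg (ratio_pos ha _).le _)
      · exact base ω ω' h0
  refine ⟨C, hC, fun ω ω' => ?_⟩
  by_cases hne : ∃ n, ω n ≠ ω' n
  · exact key _ ω ω' hne.choose_spec
  · push Not at hne
    obtain rfl : ω = ω' := funext hne
    rw [dist_self, Real.zero_rpow hs₀.ne', sub_self, abs_zero]
    simp [Comparable]

/-! ### The dimension of the curve -/

theorem dimH_Icc_zero_one : dimH (Icc (0 : ℝ) 1) = 1 := by
  rw [Real.dimH_of_nonempty_interior]
  · simp
  · simp

/-- The curve has Hausdorff dimension equal to its similarity dimension. -/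
theorem IsCoding.dimH_range (h : IsCoding ha s π τ) (hs : a ^ s + 2 * dartRatio a ^ s = 1) :
    dimH (range π) = ENNReal.ofReal s := by
  have hs₀ := exponent_pos ha hs
  obtain ⟨C, hC, hcomp⟩ := h.exists_comparable hs
  have h1 : dimH (range τ) = 1 := by
    refine le_antisymm ?_ (dimH_Icc_zero_one ▸ dimH_mono h.range_time)
    exact (dimH_mono (subset_univ _)).trans_eq Real.dimH_univ
  apply le_antisymm
  -- Any choice of code works: by comparability, codes with equal times have equal points.
  · let g : ℝ → Plane := fun t => π (Function.invFun τ t)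
    have hg : ∀ ω, g (τ ω) = π ω := by
      intro ω
      have e : τ (Function.invFun τ (τ ω)) = τ ω := Function.invFun_eq ⟨ω, rfl⟩
      have h₁ := (hcomp (Function.invFun τ (τ ω)) ω).1
      rw [e, sub_self, abs_zero, mul_zero] at h₁
      by_contra hne
      exact (Real.rpow_pos_of_pos (dist_pos.2 hne) s).not_ge h₁
    have hH : HolderOnWith (C ^ (1 / s)).toNNReal (1 / s).toNNReal g (range τ) := by
      rintro _ ⟨ω, rfl⟩ _ ⟨ω', rfl⟩
      rw [hg, hg]
      have h₁ := Real.rpow_le_rpow (by positivity) (hcomp ω ω').1 (one_div_nonneg.2 hs₀.le)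
      rw [← Real.rpow_mul dist_nonneg, mul_one_div_cancel hs₀.ne', Real.rpow_one,
        Real.mul_rpow hC (abs_nonneg _)] at h₁
      rw [edist_dist, edist_dist, ENNReal.ofReal_rpow_of_nonneg dist_nonneg (by positivity),
        ← ENNReal.ofReal_coe_nnreal, ← ENNReal.ofReal_mul (by positivity),
        Real.coe_toNNReal _ (by positivity), Real.coe_toNNReal _ (by positivity)]
      exact ENNReal.ofReal_le_ofReal h₁
    have h₂ := hH.dimH_image_le (Real.toNNReal_pos.2 (by positivity))
    have h₃ : g '' range τ = range π := by
      rw [← range_comp]; exact congrArg range (funext hg)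
    rw [h₃, h1] at h₂
    refine h₂.trans (le_of_eq ?_)
    rw [one_div s, Real.toNNReal_inv, ENNReal.coe_inv (Real.toNNReal_pos.2 hs₀).ne', one_div,
      inv_inv]
    rfl
  · let g : Plane → ℝ := fun x => τ (Function.invFun π x)
    have hg : ∀ ω, g (π ω) = τ ω := by
      intro ω
      have e : π (Function.invFun π (π ω)) = π ω := Function.invFun_eq ⟨ω, rfl⟩
      have h₁ := (hcomp (Function.invFun π (π ω)) ω).2
      rw [e, dist_self, Real.zero_rpow hs₀.ne', mul_zero] at h₁
      exact sub_eq_zero.1 (abs_nonpos_iff.1 h₁)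
    have hH : HolderOnWith C.toNNReal s.toNNReal g (range π) := by
      rintro _ ⟨ω, rfl⟩ _ ⟨ω', rfl⟩
      rw [hg, hg]
      rw [edist_dist, edist_dist, ENNReal.ofReal_rpow_of_nonneg dist_nonneg (by positivity),
        ← ENNReal.ofReal_coe_nnreal, ← ENNReal.ofReal_mul (by positivity),
        Real.coe_toNNReal _ hC, Real.coe_toNNReal _ hs₀.le]
      exact ENNReal.ofReal_le_ofReal (hcomp ω ω').2
    have h₂ := hH.dimH_image_le (Real.toNNReal_pos.2 hs₀)
    have h₃ : g '' range π = range τ := by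
      rw [← range_comp]; exact congrArg range (funext hg)
    rw [h₃, h1, ENNReal.le_div_iff_mul_le (by simp [hs₀]) (by simp), one_mul] at h₂
    exact h₂

end

/-! ### The fractal is a union of copies of the curve -/

section

variable {a s : ℝ} {ha : a ∈ Ioo (0 : ℝ) 1} {π : C(ℕ → Fin 3, Plane)} {τ : C(ℕ → Fin 3, ℝ)}

/-- The part of the fractal in `dart a`, for the part `K` of it in `triangle a`. -/
def dartPart (K : Set Plane) : Set Plane := K ∪ mirrorY '' K

/-- The fractal, for the part `K` of it in `triangle a`. -/
def assembled (K : Set Plane) : Set Plane := dartPart K ∪ mirrorX '' dartPart K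

/-- Branches `1` and `2` differ by `mirrorY`, so together they fill the dart piece; this is
self-similarity in the form that the splitting of polygons follows. -/
theorem IsCoding.range_eq (h : IsCoding ha s π τ) :
    range π = cornerMap a ha.1.ne' '' range π ∪
      dartMap a (dartRatio_pos ha).ne' '' dartPart (range π) := by
  have e : ∀ i ω, branch a ha i (π ω) = π fun n => Nat.casesOn n i ω := by
    exact fun i ω => (h.point_eq fun n => Nat.casesOn n i ω).symm
  rw [dartPart, image_union, image_image]
  apply Subset.antisymm
  · rintro _ ⟨ω, rfl⟩
    rw [h.point_eq]
    rcases (by omega : ω 0 = 0 ∨ ω 0 = 1 ∨ ω 0 = 2) with e | e | e <;> rw [e]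
    exacts [Or.inl ⟨_, ⟨_, rfl⟩, rfl⟩, Or.inr (Or.inl ⟨_, ⟨_, rfl⟩, rfl⟩),
      Or.inr (Or.inr ⟨_, ⟨_, rfl⟩, rfl⟩)]
  · rintro _ (⟨_, ⟨ω, rfl⟩, rfl⟩ | ⟨_, ⟨ω, rfl⟩, rfl⟩ | ⟨_, ⟨ω, rfl⟩, rfl⟩)
    exacts [⟨_, (e 0 ω).symm⟩, ⟨_, (e 1 ω).symm⟩, ⟨_, (e 2 ω).symm⟩]

theorem mem_emptyPolygons_succ {k : ℕ} {Q : Set Plane} :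
    Q ∈ emptyPolygons a (k + 1) ↔ ∃ P ∈ emptyPolygons a k, Q ∈ children a (k + 1) P :=
  Iff.rfl

theorem emptyPolygons_one (ha : a ∈ Ioo (0 : ℝ) 1) :
    emptyPolygons a 1 = {dart a, mirrorX '' dart a} := by
  rw [← children_initialRhombus ha]
  ext Q
  rw [mem_emptyPolygons_succ]
  simp [emptyPolygons]

theorem AxisSimilarity.children_image_dart (ha : a ∈ Ioo (0 : ℝ) 1) {r : ℝ} {k : ℕ}
    {f : Plane ≃ₜ Plane} (hf : AxisSimilarity r (k + 1) f) :
    children a (k + 1) (f '' dart a) = {f '' triangle a, f '' (mirrorY '' triangle a)} := by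
  have := hf.children_image a 0 (dart a)
  rwa [zero_add, children_dart ha, image_pair] at this

theorem AxisSimilarity.children_image_triangle (ha : a ∈ Ioo (0 : ℝ) 1) {r : ℝ} {k : ℕ}
    {f : Plane ≃ₜ Plane} (hf : AxisSimilarity r k f) :
    children a (k + 1) (f '' triangle a) = {f '' (cornerMap a ha.1.ne' '' triangle a),
      f '' (dartMap a (dartRatio_pos ha).ne' '' dart a)} := by
  have := hf.children_image a 1 (triangle a)
  rwa [add_comm, children_triangle ha (dartRatio_pos ha), image_pair] at this

theorem triangle_subset_dart (ha : a ∈ Ioo (0 : ℝ) 1) : triangle a ⊆ dart a := by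
  intro x hx
  have h₀ := (dist_le_of_mem_triangle_bottom ha hx).1
  rw [dart, mem_ofPred_eq, abs_of_nonneg h₀]
  exact ⟨hx.1, hx.2.1⟩

theorem mirrorY_image_triangle_subset_dart (ha : a ∈ Ioo (0 : ℝ) 1) :
    mirrorY '' triangle a ⊆ dart a := by
  rintro _ ⟨x, hx, rfl⟩
  have := triangle_subset_dart ha hx
  rw [dart, mem_ofPred_eq] at this ⊢
  simpa using this

theorem dist_le_of_mem_dart (ha : a ∈ Ioo (0 : ℝ) 1) {x : Plane} (hx : x ∈ dart a) :
    dist x !₂[0, 1] ≤ 1 / a + 2 := by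
  obtain ⟨h₁, h₂⟩ := hx
  obtain ⟨ha₀, ha₁⟩ := ha
  have ha₂ : 0 < 1 - a ^ 2 := by nlinarith
  have h₀ : 0 ≤ x 0 := by
    by_contra hc
    push Not at hc
    nlinarith [mul_le_mul_of_nonneg_left h₁ ha₀.le, mul_pos (neg_pos.2 hc) ha₂]
  have h₃ : |x 1| ≤ 1 := by nlinarith [mul_nonneg ha₀.le h₀]
  have h₄ : x 0 ≤ 1 / a := by rw [le_div_iff₀ ha₀]; nlinarith [abs_nonneg (x 1)]
  refine (dist_le_abs_add_abs _ _).trans (add_le_add ?_ ?_)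
  · simpa [abs_of_nonneg h₀] using h₄
  · have := abs_le.1 h₃
    rw [abs_le]
    simp
    constructor <;> linarith

theorem subset_stage {k : ℕ} {Q : Set Plane} (hQ : Q ∈ emptyPolygons a k) : Q ⊆ stage a k :=
  subset_biUnion_of_mem (u := fun Q => Q) hQ

theorem IsCoding.range_subset (h : IsCoding ha s π τ) : range π ⊆ triangle a := by
  rintro _ ⟨ω, rfl⟩; exact h.point_mem ω

/-- The model triangle is split at an odd iteration and the model dart at an even one, hence the
parities `k` and `k + 1` for polygons that are split at iteration `k + 1`. -/
theorem IsCoding.image_subset_stage (h : IsCoding ha s π τ) (j : ℕ) :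
    ∀ (k : ℕ) (r : ℝ) (f : Plane ≃ₜ Plane),
      (AxisSimilarity r k f → f '' triangle a ∈ emptyPolygons a k →
        f '' range π ⊆ stage a (k + j)) ∧
      (AxisSimilarity r (k + 1) f → f '' dart a ∈ emptyPolygons a k →
        f '' dartPart (range π) ⊆ stage a (k + j)) := by
  have hp := dartRatio_pos ha
  induction j with
  | zero =>
    refine fun k r f => ⟨fun hf hm => ?_, fun hf hm => ?_⟩
    · exact (image_mono h.range_subset).trans (subset_stage hm)
    · refine (image_mono ?_).trans (subset_stage hm)
      exact union_subset (h.range_subset.trans (triangle_subset_dart ha))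
        ((image_mono h.range_subset).trans (mirrorY_image_triangle_subset_dart ha))
  | succ j ih =>
    refine fun k r f => ⟨fun hf hm => ?_, fun hf hm => ?_⟩
    · rw [h.range_eq, image_union, ← add_assoc, add_right_comm]
      have hc := hf.children_image_triangle ha
      refine union_subset ?_ ?_
      · have h₁ := (axisSimilarity_cornerMap ha.1).trans hf
        have h₂ := (ih (k + 1) _ _).1 h₁ (mem_emptyPolygons_succ.2 ⟨_, hm, by
          rw [hc]; left; rw [image_image]; rfl⟩)
        rwa [image_image]
      · have h₁ := (axisSimilarity_dartMap hp even_two).trans hf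
        have h₂ := (ih (k + 1) _ _).2 h₁ (mem_emptyPolygons_succ.2 ⟨_, hm, by
          rw [hc]; right; rw [image_image]; rfl⟩)
        rwa [image_image]
    · rw [dartPart, image_union, ← add_assoc, add_right_comm]
      have hc := hf.children_image_dart ha
      refine union_subset ?_ ?_
      · exact (ih (k + 1) _ _).1 hf (mem_emptyPolygons_succ.2 ⟨_, hm, by rw [hc]; left; rfl⟩)
      · have h₁ := (axisSimilarity_mirrorY Even.zero).trans hf
        have h₂ := (ih (k + 1) _ _).1 h₁ (mem_emptyPolygons_succ.2 ⟨_, hm, by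
          rw [hc]; right; rw [image_image]; rfl⟩)
        rwa [image_image]

theorem axisSimilarity_refl : AxisSimilarity 1 2 (Homeomorph.refl Plane) :=
  ⟨one_pos, fun _ x y => by simp, fun h => absurd even_two h⟩

theorem IsCoding.assembled_subset_fractal (h : IsCoding ha s π τ) :
    assembled (range π) ⊆ fractal a := by
  refine subset_iInter₂ fun k hk => ?_
  obtain ⟨j, rfl⟩ := Nat.exists_eq_add_of_le (mem_Ici.1 hk)
  refine union_subset ?_ ?_
  · have := (h.image_subset_stage j 1 1 (Homeomorph.refl Plane)).2 axisSimilarity_refl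
      (by rw [emptyPolygons_one ha]; left; simp)
    simpa using this
  · exact (h.image_subset_stage j 1 1 mirrorX).2 (axisSimilarity_mirrorX even_two)
      (by rw [emptyPolygons_one ha]; right; rfl)

/-- Passing from a dart to a triangle does not lower the ratio, but passing from a triangle to a
dart lowers it by `dartRatio a ≤ κ ^ 2`. Weighting triangles with one extra `κ` makes every step
gain exactly one factor `κ`. -/
theorem IsCoding.emptyPolygons_succ (h : IsCoding ha s π τ) {κ : ℝ} (hκ₀ : 0 ≤ κ) (hκ : a ≤ κ)
    (hκ' : dartRatio a ≤ κ ^ 2) (k : ℕ) : ∀ Q ∈ emptyPolygons a (k + 1), ∃ r f,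
      (AxisSimilarity r (k + 1) f ∧ Q = f '' triangle a ∧ f '' range π ⊆ assembled (range π) ∧
        r * κ ≤ κ ^ k) ∨
      (AxisSimilarity r (k + 1 + 1) f ∧ Q = f '' dart a ∧
        f '' dartPart (range π) ⊆ assembled (range π) ∧ r ≤ κ ^ k) := by
  have hp := dartRatio_pos ha
  induction k with
  | zero =>
    intro Q hQ
    rw [zero_add, emptyPolygons_one ha] at hQ
    rcases hQ with rfl | rfl
    · exact ⟨1, Homeomorph.refl Plane, Or.inr ⟨axisSimilarity_refl, by simp,
        by simp [assembled], by simp⟩⟩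
    · exact ⟨1, mirrorX, Or.inr ⟨axisSimilarity_mirrorX even_two, rfl,
        subset_union_right, by simp⟩⟩
  | succ k ih =>
    intro Q hQ
    obtain ⟨P, hP, hQ⟩ := mem_emptyPolygons_succ.1 hQ
    obtain ⟨r, f, ⟨hf, rfl, hs, hr⟩ | ⟨hf, rfl, hs, hr⟩⟩ := ih P hP
    · rw [hf.children_image_triangle ha] at hQ
      rw [h.range_eq, image_union, union_subset_iff, ← h.range_eq, image_image, image_image] at hs
      have hr₀ := mul_nonneg hf.pos.le hκ₀
      rcases hQ with rfl | rfl
      · refine ⟨_, _, Or.inl ⟨(axisSimilarity_cornerMap ha.1).trans hf, ?_, hs.1, ?_⟩⟩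
        · rw [image_image]; rfl
        · calc r * a * κ = r * κ * a := by ring
            _ ≤ κ ^ k * κ := mul_le_mul hr hκ ha.1.le (by positivity)
            _ = κ ^ (k + 1) := (pow_succ _ _).symm
      · refine ⟨_, _, Or.inr ⟨(axisSimilarity_dartMap hp even_two).trans hf, ?_, hs.2, ?_⟩⟩
        · rw [image_image]; rfl
        · calc r * dartRatio a ≤ r * κ ^ 2 := by gcongr; exact hf.pos.le
            _ = r * κ * κ := by ring
            _ ≤ κ ^ k * κ := by gcongr
            _ = κ ^ (k + 1) := (pow_succ _ _).symm
    · rw [hf.children_image_dart ha] at hQ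
      rw [dartPart, image_union, union_subset_iff, image_image] at hs
      have hr' : r * κ ≤ κ ^ (k + 1) := by rw [pow_succ]; gcongr
      rcases hQ with rfl | rfl
      · exact ⟨_, _, Or.inl ⟨hf, rfl, hs.1, hr'⟩⟩
      · refine ⟨_, _, Or.inl ⟨(axisSimilarity_mirrorY Even.zero).trans hf, ?_, hs.2, ?_⟩⟩
        · rw [image_image]; rfl
        · rwa [mul_one]

theorem isClosed_assembled (π : C(ℕ → Fin 3, Plane)) :
    IsClosed (assembled (range π)) := by
  have h₁ : IsCompact (range π) := isCompact_range π.continuous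
  have h₂ : IsCompact (dartPart (range π)) := h₁.union (h₁.image mirrorY.continuous)
  exact (h₂.union (h₂.image mirrorX.continuous)).isClosed

theorem IsCoding.fractal_subset_assembled (h : IsCoding ha s π τ) :
    fractal a ⊆ assembled (range π) := by
  intro x hx
  obtain ⟨κ, hκ₀, hκ₁, hκa, hκσ⟩ : ∃ κ : NNReal, 0 < κ ∧ κ < 1 ∧ a ≤ κ ∧
      dartRatio a ≤ (κ : ℝ) ^ 2 := by
    have h₀ : (0 : ℝ) < max a (3 / 4) := ha.1.trans_le (le_max_left _ _)
    -- `3 / 4` serves because `dartRatio a ≤ 1 / 2 < (3 / 4) ^ 2`.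
    refine ⟨⟨max a (3 / 4), h₀.le⟩, h₀, max_lt ha.2 (by norm_num), le_max_left _ _, ?_⟩
    have h₁ : (3 / 4 : ℝ) ≤ max a (3 / 4) := le_max_right _ _
    change dartRatio a ≤ max a (3 / 4) ^ 2
    have : dartRatio a ≤ 1 / 2 := by unfold dartRatio; nlinarith [sq_nonneg a]
    nlinarith
  have hκ₀' : (0 : ℝ) < κ := hκ₀
  have hA : !₂[0, 1] ∈ range π := ⟨_, h.zero_point⟩
  have h2 : (0 : ℝ) ≤ 1 / a + 2 := by have := ha.1; positivity
  refine mem_of_forall_exists_dist_le (M := (1 / a + 2) / κ) (isClosed_assembled π) hκ₁ fun k => ?_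
  obtain ⟨Q, hQ, hxQ⟩ := mem_iUnion₂.1 (mem_iInter₂.1 hx (k + 1) (by simp))
  obtain ⟨r, f, ⟨hf, rfl, hs, hr⟩ | ⟨hf, rfl, hs, hr⟩⟩ :=
    h.emptyPolygons_succ hκ₀'.le hκa hκσ k Q hQ
  · obtain ⟨z, hz, rfl⟩ := hxQ
    refine ⟨f !₂[0, 1], hs ⟨_, hA, rfl⟩, ?_⟩
    rw [hf.dist_eq, mul_div_assoc', le_div_iff₀ hκ₀', mul_right_comm]
    exact mul_le_mul hr (dist_le_of_mem_dart ha (triangle_subset_dart ha hz)) dist_nonneg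
      (by positivity)
  · obtain ⟨z, hz, rfl⟩ := hxQ
    refine ⟨f !₂[0, 1], hs ⟨_, Or.inl hA, rfl⟩, ?_⟩
    rw [hf.dist_eq]
    refine mul_le_mul hr ((dist_le_of_mem_dart ha hz).trans ?_) dist_nonneg (by positivity)
    exact le_div_self h2 hκ₀' (le_of_lt hκ₁)

/-! ### The dimension of the fractal -/

theorem AxisSimilarity.dimH_image {n : ℕ} {f : Plane ≃ₜ Plane} (hf : AxisSimilarity 1 n f)
    (K : Set Plane) : dimH (f '' K) = dimH K :=
  (Isometry.of_dist_eq fun x y => by rw [hf.dist_eq, one_mul]).dimH_image K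

theorem dimH_assembled (K : Set Plane) : dimH (assembled K) = dimH K := by
  rw [assembled, dimH_union, (axisSimilarity_mirrorX Even.zero).dimH_image, max_self, dartPart,
    dimH_union, (axisSimilarity_mirrorY Even.zero).dimH_image, max_self]

theorem dimH_fractal (ha : a ∈ Ioo (0 : ℝ) 1) (hs : a ^ s + 2 * dartRatio a ^ s = 1) :
    dimH (fractal a) = ENNReal.ofReal s := by
  obtain ⟨π, τ, h⟩ := exists_isCoding ha (exponent_pos ha hs) hs
  rw [h.fractal_subset_assembled.antisymm h.assembled_subset_fractal, dimH_assembled,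
    h.dimH_range hs]

end

/-! ### The exponent -/

section

variable {a s t : ℝ}

theorem dartRatio_lt_one (ha : a ∈ Ioo (0 : ℝ) 1) : dartRatio a < 1 := ratio_lt_one ha 1

theorem exists_exponent (ha : a ∈ Ioo (0 : ℝ) 1) :
    ∃ s : ℝ, 1 ≤ s ∧ a ^ s + 2 * dartRatio a ^ s = 1 := by
  have hσ := dartRatio_pos ha
  obtain ⟨ha₀, ha₁⟩ := ha
  have hc : ContinuousOn (fun s : ℝ => a ^ s + 2 * dartRatio a ^ s) (Icc 1 2) :=
    ((Real.continuous_const_rpow ha₀.ne').add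
      (continuous_const.mul (Real.continuous_const_rpow hσ.ne'))).continuousOn
  -- At exponent `1` the sum is `1 + a - a ^ 2`; at exponent `2` it falls short of `1` by `(1 - a ^
  -- 2) * (1 + a ^ 2) / 2`.
  obtain ⟨s, hs, h⟩ := intermediate_value_Icc' one_le_two hc (show (1 : ℝ) ∈ _ by
    constructor
    · simp only [Real.rpow_two, dartRatio]
      nlinarith [mul_pos (show 0 < 1 - a ^ 2 by nlinarith) (show 0 < 1 + a ^ 2 by positivity)]
    · simp only [Real.rpow_one, dartRatio]; nlinarith)
  exact ⟨s, hs.1, h⟩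

theorem exponent_le (ha : a ∈ Ioo (0 : ℝ) 1) (hs : a ^ s + 2 * dartRatio a ^ s = 1)
    (ht : a ^ t + 2 * dartRatio a ^ t ≤ 1) : s ≤ t := by
  by_contra hc
  push Not at hc
  have h₁ := Real.rpow_lt_rpow_of_exponent_gt ha.1 ha.2 hc
  have h₂ := Real.rpow_lt_rpow_of_exponent_gt (dartRatio_pos ha) (dartRatio_lt_one ha) hc
  linarith

theorem one_le_dimH_fractal (ha : a ∈ Ioo (0 : ℝ) 1) : 1 ≤ dimH (fractal a) := by
  obtain ⟨s, hs₁, hs⟩ := exists_exponent ha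
  rw [dimH_fractal ha hs]
  exact ENNReal.one_le_ofReal.2 hs₁

theorem dimH_fractal_le (ha : a ∈ Ioo (0 : ℝ) 1) (ht : a ^ t + 2 * dartRatio a ^ t ≤ 1) :
    dimH (fractal a) ≤ ENNReal.ofReal t := by
  obtain ⟨s, -, hs⟩ := exists_exponent ha
  rw [dimH_fractal ha hs]
  exact ENNReal.ofReal_le_ofReal (exponent_le ha hs ht)

theorem tendsto_dimH_fractal {l : Filter ℝ} (hl : ∀ᶠ a in l, a ∈ Ioo (0 : ℝ) 1)
    (h : ∀ t : ℝ, 1 < t → ∀ᶠ a in l, a ^ t + 2 * dartRatio a ^ t ≤ 1) :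
    Tendsto (fun a : ℝ => dimH (fractal a)) l (𝓝 1) := by
  refine tendsto_order.2 ⟨fun b hb => ?_, fun b hb => ?_⟩
  · filter_upwards [hl] with a ha using hb.trans_le (one_le_dimH_fractal ha)
  · obtain ⟨r, hr₁, hr⟩ := ENNReal.lt_iff_exists_nnreal_btwn.1 hb
    filter_upwards [hl, h r (by exact_mod_cast hr₁)] with a ha ht
    exact (dimH_fractal_le ha ht).trans_lt (by simpa using hr)

theorem eventually_le_one_of_zero (ht : 1 < t) :
    ∀ᶠ a in 𝓝[>] (0 : ℝ), a ^ t + 2 * dartRatio a ^ t ≤ 1 := by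
  have ht₀ : 0 < t := by linarith
  have hc : Continuous fun a : ℝ => a ^ t + 2 * dartRatio a ^ t := by
    unfold dartRatio
    exact (Real.continuous_rpow_const ht₀.le).add (continuous_const.mul
      ((Real.continuous_rpow_const ht₀.le).comp (by fun_prop)))
  have h₀ : (0 : ℝ) ^ t + 2 * dartRatio 0 ^ t < 1 := by
    have := Real.rpow_lt_rpow_of_exponent_gt (x := 1 / 2) (by norm_num) (by norm_num) ht
    rw [Real.rpow_one] at this
    rw [Real.zero_rpow ht₀.ne', dartRatio]
    norm_num at this ⊢
    linarith
  exact ((hc.continuousAt.eventually (gt_mem_nhds h₀)).filter_mono nhdsWithin_le_nhds).mono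
    fun a h => h.le

/-- The sum equals `1` at `a = 1`, so continuity alone does not decide. Instead `a ^ t ≤ a`, and `2
* (1 - a) ^ t` is eventually at most `1 - a`. -/
theorem eventually_le_one_of_one (ht : 1 < t) :
    ∀ᶠ a in 𝓝[<] (1 : ℝ), a ^ t + 2 * dartRatio a ^ t ≤ 1 := by
  have ht₀ : 0 < t - 1 := by linarith
  have hc : Continuous fun a : ℝ => 2 * (1 - a) ^ (t - 1) :=
    continuous_const.mul ((Real.continuous_rpow_const ht₀.le).comp (by fun_prop))
  have h₀ : 2 * (1 - 1 : ℝ) ^ (t - 1) < 1 := by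
    rw [sub_self, Real.zero_rpow ht₀.ne']; norm_num
  filter_upwards [(hc.continuousAt.eventually (gt_mem_nhds h₀)).filter_mono nhdsWithin_le_nhds,
    Ioo_mem_nhdsLT (show (0 : ℝ) < 1 by norm_num)] with a h ha
  have h : 2 * (1 - a) ^ (t - 1) < 1 := h
  have hδ : 0 < 1 - a := sub_pos.2 ha.2
  have h₁ : a ^ t ≤ a := by
    simpa using Real.rpow_le_rpow_of_exponent_ge ha.1 ha.2.le ht.le
  have h₂ : dartRatio a ^ t ≤ (1 - a) ^ t := by
    refine Real.rpow_le_rpow (dartRatio_pos ha).le ?_ (by linarith)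
    unfold dartRatio; nlinarith [ha.1]
  have h₃ : (1 - a) ^ t = (1 - a) ^ (t - 1) * (1 - a) := by
    rw [← Real.rpow_add_one hδ.ne', sub_add_cancel]
  nlinarith

end

/-! ### The maximal exponent -/

section

variable {S x : ℝ}

theorem logb_three_four_bounds : 1 < Real.logb 3 4 ∧ Real.logb 3 4 < 3 / 2 := by
  constructor
  · rw [Real.lt_logb_iff_rpow_lt (by norm_num) (by norm_num)]; norm_num
  -- The upper bound is `4 ^ 2 < 3 ^ 3`.
  · have h : Real.logb 3 (4 ^ 2) < 3 := by
      rw [Real.logb_lt_iff_lt_rpow (by norm_num) (by norm_num)]; norm_num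
    rw [Real.logb_pow] at h
    push_cast at h
    linarith

theorem logb_three_four_mul_log : Real.logb 3 4 * Real.log 3 = 2 * Real.log 2 := by
  rw [Real.logb, div_mul_cancel₀ _ (Real.log_pos (by norm_num)).ne',
    show (4 : ℝ) = 2 ^ 2 by norm_num, Real.log_pow]
  norm_num

/-- `u ^ S + 2 ((1 - u ^ 2) / 2) ^ S` as a function of `x = u ^ 2`. -/
def pressure (S x : ℝ) : ℝ := x ^ (S / 2) + 2 * ((1 - x) / 2) ^ S

/-- The logarithmic quantity that governs the sign of the derivative of `pressure S`. -/
def slope (S x : ℝ) : ℝ := (S / 2 - 1) * Real.log x - (S - 1) * Real.log (1 - x)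

theorem continuous_pressure (hS : 0 < S) : Continuous (pressure S) :=
  (Real.continuous_rpow_const (by positivity)).add
    (continuous_const.mul ((Real.continuous_rpow_const hS.le).comp (by fun_prop)))

theorem hasDerivAt_pressure (hx : x ∈ Ioo (0 : ℝ) 1) :
    HasDerivAt (pressure S) (S * (x ^ (S / 2 - 1) / 2 - ((1 - x) / 2) ^ (S - 1))) x := by
  have h₁ := (hasDerivAt_id x).rpow_const (p := S / 2) (Or.inl hx.1.ne')
  have h₂ : HasDerivAt (fun x : ℝ => (1 - x) / 2) (-1 / 2) x :=
    ((hasDerivAt_id x).const_sub 1).div_const 2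
  have hx' : (1 - x) / 2 ≠ 0 := (div_pos (sub_pos.2 hx.2) two_pos).ne'
  have h₃ := (h₂.rpow_const (p := S) (Or.inl hx')).const_mul 2
  refine (h₁.add h₃).congr_deriv ?_
  simp only [id_eq]
  ring

theorem half_rpow_eq_exp (hx : 0 < x) :
    x ^ (S / 2 - 1) / 2 = Real.exp ((S / 2 - 1) * Real.log x - Real.log 2) := by
  rw [Real.exp_sub, Real.exp_log two_pos, Real.rpow_def_of_pos hx, mul_comm]

theorem rpow_eq_exp (hx : x < 1) :
    ((1 - x) / 2) ^ (S - 1) = Real.exp ((S - 1) * Real.log (1 - x) - (S - 1) * Real.log 2) := by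
  have h : 0 < 1 - x := sub_pos.2 hx
  rw [Real.rpow_def_of_pos (by positivity), Real.log_div h.ne' two_ne_zero]
  ring_nf

theorem deriv_pressure_nonneg (hS : 0 < S) (hx : x ∈ Ioo (0 : ℝ) 1)
    (h : (2 - S) * Real.log 2 ≤ slope S x) : 0 ≤ deriv (pressure S) x := by
  rw [(hasDerivAt_pressure hx).deriv, half_rpow_eq_exp hx.1, rpow_eq_exp hx.2]
  refine mul_nonneg hS.le (sub_nonneg.2 (Real.exp_le_exp.2 ?_))
  unfold slope at h
  linarith

theorem deriv_pressure_nonpos (hS : 0 < S) (hx : x ∈ Ioo (0 : ℝ) 1)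
    (h : slope S x ≤ (2 - S) * Real.log 2) : deriv (pressure S) x ≤ 0 := by
  rw [(hasDerivAt_pressure hx).deriv, half_rpow_eq_exp hx.1, rpow_eq_exp hx.2]
  refine mul_nonpos_of_nonneg_of_nonpos hS.le (sub_nonpos.2 (Real.exp_le_exp.2 ?_))
  unfold slope at h
  linarith

/-- Both logarithms enter with a nonpositive coefficient. Consequently the region where the pressure
decreases is an interval. -/
theorem convexOn_slope (h₁ : 1 ≤ S) (h₂ : S ≤ 2) : ConvexOn ℝ (Ioo 0 1) (slope S) := by
  refine ⟨convex_Ioo 0 1, fun x hx y hy p q hp hq hpq => ?_⟩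
  have hl := strictConcaveOn_log_Ioi.concaveOn.2 (mem_Ioi.2 hx.1) (mem_Ioi.2 hy.1) hp hq hpq
  have hr := strictConcaveOn_log_Ioi.concaveOn.2 (mem_Ioi.2 (sub_pos.2 hx.2))
    (mem_Ioi.2 (sub_pos.2 hy.2)) hp hq hpq
  simp only [smul_eq_mul, slope] at *
  rw [show p * (1 - x) + q * (1 - y) = 1 - (p * x + q * y) by linear_combination hpq] at hr
  nlinarith [mul_le_mul_of_nonneg_left hl (show 0 ≤ 1 - S / 2 by linarith),
    mul_le_mul_of_nonneg_left hr (show 0 ≤ S - 1 by linarith)]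

theorem slope_third : slope (Real.logb 3 4) (1 / 3) = (2 - Real.logb 3 4) * Real.log 2 := by
  have h := logb_three_four_mul_log
  rw [slope, show (1 : ℝ) - 1 / 3 = 2 / 3 by norm_num, Real.log_div two_ne_zero three_ne_zero,
    one_div, Real.log_inv]
  linarith

theorem le_slope_of_le_third (h₀ : 0 < x) (h : x ≤ 1 / 3) :
    (2 - Real.logb 3 4) * Real.log 2 ≤ slope (Real.logb 3 4) x := by
  obtain ⟨h₁, h₂⟩ := logb_three_four_bounds
  -- Both estimates are sharp at `x = 1 / 3`; combined they bound the excess below by `(1 - 3 * x) *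
  -- (3 / 2 - S)`, which is where `S < 3 / 2` is needed.
  have e₁ := Real.log_le_sub_one_of_pos (show 0 < 3 * x by linarith)
  have e₂ := Real.log_le_sub_one_of_pos (show 0 < 3 / 2 * (1 - x) by linarith)
  rw [Real.log_mul (by norm_num) h₀.ne'] at e₁
  rw [Real.log_mul (by norm_num) (by linarith), Real.log_div three_ne_zero two_ne_zero] at e₂
  have h₃ := logb_three_four_mul_log
  unfold slope
  nlinarith [mul_le_mul_of_nonneg_left e₁ (show 0 ≤ 1 - Real.logb 3 4 / 2 by linarith),
    mul_le_mul_of_nonneg_left e₂ (show 0 ≤ Real.logb 3 4 - 1 by linarith),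
    mul_nonneg (show 0 ≤ 3 / 2 - Real.logb 3 4 by linarith) (show 0 ≤ 1 / 3 - x by linarith)]

theorem third_rpow : (1 / 3 : ℝ) ^ Real.logb 3 4 = 1 / 4 := by
  rw [Real.div_rpow zero_le_one (by norm_num), Real.one_rpow,
    Real.rpow_logb (by norm_num) (by norm_num) (by norm_num)]

theorem third_rpow_half : (1 / 3 : ℝ) ^ (Real.logb 3 4 / 2) = 1 / 2 := by
  rw [div_eq_mul_one_div (Real.logb 3 4), Real.rpow_mul (by norm_num), third_rpow,
    ← Real.sqrt_eq_rpow, show (1 / 4 : ℝ) = (1 / 2) ^ 2 by norm_num, Real.sqrt_sq (by norm_num)]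

theorem pressure_third : pressure (Real.logb 3 4) (1 / 3) = 1 := by
  rw [pressure, third_rpow_half, show ((1 : ℝ) - 1 / 3) / 2 = 1 / 3 by norm_num, third_rpow]
  norm_num

theorem pressure_one (hS : 0 < S) : pressure S 1 = 1 := by
  simp [pressure, hS.ne']

theorem pressure_le_one (hx : x ∈ Ioo (0 : ℝ) 1) : pressure (Real.logb 3 4) x ≤ 1 := by
  obtain ⟨h₁, h₂⟩ := logb_three_four_bounds
  set S := Real.logb 3 4 with hS
  have hS₀ : 0 < S := by linarith
  have hdiff : ∀ y ∈ Ioo (0 : ℝ) 1, DifferentiableWithinAt ℝ (pressure S) (Ioo 0 1) y :=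
    fun y hy => (hasDerivAt_pressure hy).differentiableAt.differentiableWithinAt
  have hmono : ∀ u v, 0 < u → u ≤ v → v ≤ 1 →
      (∀ y ∈ Ioo u v, (2 - S) * Real.log 2 ≤ slope S y) → pressure S u ≤ pressure S v := by
    intro u v hu huv hv h
    refine monotoneOn_of_deriv_nonneg (convex_Icc u v) (continuous_pressure hS₀).continuousOn
      ?_ ?_ (left_mem_Icc.2 huv) (right_mem_Icc.2 huv) huv
    · rw [interior_Icc]
      exact fun y hy => ((hdiff y ⟨hu.trans hy.1, hy.2.trans_le hv⟩).mono
        (Ioo_subset_Ioo hu.le hv))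
    · rw [interior_Icc]
      exact fun y hy => deriv_pressure_nonneg hS₀ ⟨hu.trans hy.1, hy.2.trans_le hv⟩ (h y hy)
  rcases le_total x (1 / 3) with hx' | hx'
  · rw [← pressure_third]
    exact hmono x (1 / 3) hx.1 hx' (by norm_num) fun y hy =>
      le_slope_of_le_third (hx.1.trans hy.1) hy.2.le
  have hconv := ((convexOn_slope h₁.le (by linarith)).convex_le ((2 - S) * Real.log 2)).ordConnected
  have hthird : (1 / 3 : ℝ) ∈ {y ∈ Ioo (0 : ℝ) 1 | slope S y ≤ (2 - S) * Real.log 2} :=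
    ⟨by norm_num, slope_third.le⟩
  -- The sublevel set is an interval containing `1 / 3`. If it contains `x`, the pressure decreases
  -- from `1 / 3` to `x`; if not, it contains nothing to the right of `x`, and the pressure
  -- increases from `x` to its value `1` at `1`.
  by_cases hle : slope S x ≤ (2 - S) * Real.log 2
  · rw [← pressure_third]
    refine antitoneOn_of_deriv_nonpos (convex_Icc (1 / 3) x) (continuous_pressure hS₀).continuousOn
      ?_ ?_ (left_mem_Icc.2 hx') (right_mem_Icc.2 hx') hx'
    · rw [interior_Icc]
      exact fun y hy => (hdiff y ⟨by linarith [hy.1], hy.2.trans hx.2⟩).mono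
        (Ioo_subset_Ioo (by norm_num) hx.2.le)
    · rw [interior_Icc]
      exact fun y hy => deriv_pressure_nonpos hS₀ ⟨by linarith [hy.1], hy.2.trans hx.2⟩
        (hconv.out hthird ⟨hx, hle⟩ (Ioo_subset_Icc_self hy)).2
  · rw [← pressure_one hS₀]
    refine hmono x 1 hx.1 hx.2.le le_rfl fun y hy => ?_
    by_contra hc
    push Not at hc
    exact hle (hconv.out hthird ⟨⟨hx.1.trans hy.1, hy.2⟩, hc.le⟩ ⟨hx', hy.1.le⟩).2

theorem rpow_add_le_one {a : ℝ} (ha : a ∈ Ioo (0 : ℝ) 1) :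
    a ^ Real.logb 3 4 + 2 * dartRatio a ^ Real.logb 3 4 ≤ 1 := by
  have h := pressure_le_one (x := a ^ 2) ⟨pow_pos ha.1 2, by nlinarith [ha.1, ha.2]⟩
  rw [pressure, ← Real.rpow_natCast_mul ha.1.le] at h
  rwa [show ((2 : ℕ) : ℝ) * (Real.logb 3 4 / 2) = Real.logb 3 4 by push_cast; ring] at h

theorem one_div_sqrt_three_mem : 1 / √3 ∈ Ioo (0 : ℝ) 1 := by
  refine ⟨by positivity, ?_⟩
  rw [div_lt_one (by positivity)]
  exact Real.lt_sqrt_of_sq_lt (by norm_num)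

theorem one_div_sqrt_three_rpow_add :
    (1 / √3) ^ Real.logb 3 4 + 2 * dartRatio (1 / √3) ^ Real.logb 3 4 = 1 := by
  have h := pressure_third
  have e : (1 / √3 : ℝ) ^ 2 = 1 / 3 := by rw [div_pow, Real.sq_sqrt (by norm_num)]; norm_num
  rw [pressure, ← e, ← Real.rpow_natCast_mul (by positivity)] at h
  rwa [show ((2 : ℕ) : ℝ) * (Real.logb 3 4 / 2) = Real.logb 3 4 by push_cast; ring] at h

theorem dimH_fractal_one_div_sqrt_three :
    dimH (fractal (1 / √3)) = ENNReal.ofReal (Real.logb 3 4) :=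
  dimH_fractal one_div_sqrt_three_mem one_div_sqrt_three_rpow_add

end

end Gasket

end

theorem mainTheorem4 :
    IsMaxOn (fun a : ℝ => dimH (Gasket.fractal a)) (Ioo (0 : ℝ) 1) (1 / √3) ∧
    dimH (Gasket.fractal (1 / √3)) = ENNReal.ofReal (Real.logb 3 4) ∧
    Tendsto (fun a : ℝ => dimH (Gasket.fractal a)) (𝓝[>] (0 : ℝ)) (𝓝 1) ∧
    Tendsto (fun a : ℝ => dimH (Gasket.fractal a)) (𝓝[<] (1 : ℝ)) (𝓝 1) := by
  refine ⟨fun a ha => ?_, Gasket.dimH_fractal_one_div_sqrt_three,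
    Gasket.tendsto_dimH_fractal (Ioo_mem_nhdsGT zero_lt_one)
      fun t ht => Gasket.eventually_le_one_of_zero ht,
    Gasket.tendsto_dimH_fractal (Ioo_mem_nhdsLT zero_lt_one)
      fun t ht => Gasket.eventually_le_one_of_one ht⟩
  change dimH (Gasket.fractal a) ≤ dimH (Gasket.fractal (1 / √3))
  rw [Gasket.dimH_fractal_one_div_sqrt_three]
  exact Gasket.dimH_fractal_le ha (Gasket.rpow_add_le_one ha)
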